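/- **Vectorial data.** Let $V$ be a finite-dimensional real vector space, $(\alpha_i)_{i\in I}$ a finite linearly independent family in $V^*$ and $(\alpha_i^\vee)_{i\in I}$ a family in $V$ with $\alpha_i(\alpha_i^\vee)=2$. Put $r_i(v)=v-\alpha_i(v)\alpha_i^\vee$ and $W^v=\langle r_i\mid i\in I\rangle\subset GL(V)$. Assume that $(W^v,S)$, $S=\{r_i\}$, is a Coxeter system (with length $\ell$) whose Coxeter matrix consists of the orders of the $r_ir_j$, and that the set of real roots $\Phi=\{w\alpha_i\mid w\in W^v,i\in I\}$ has the usual properties: $r_\alpha=wr_iw^{-1}$, of the form $v\mapsto v-\alpha(v)\alpha^\vee$, depends only on $\alpha=w\alpha_i$; with $\Phi^+=\Phi\cap\sum_i\mathbb R_{\ge0}\alpha_i$ one has $\Phi=\Phi^+\sqcup-\Phi^+$; only $1\in W^v$ stabilizes $\Phi^+$; $w\alpha_i\in\Phi^+\Leftrightarrow\ell(wr_i)>\ell(w)$; and $\Phi\cap\mathbb R_{\ge0}\alpha=\{\alpha\}$ for $\alpha\in\Phi$. For $J\subset I$ let $F^v(J)=\{v\mid\alpha_i(v)=0\ (i\in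 J),\ \alpha_i(v)>0\ (i\notin J)\}$ and $C^v_f=F^v(\emptyset)$. The vectorial facets (chambers) of sign $\varepsilon=\pm1$ are the $\varepsilon wF^v(J)$ (the $\varepsilon wC^v_f$), $w\in W^v$; such a facet is spherical if $\langle r_i\mid i\in J\rangle$ is finite. The Tits cone $\mathcal T$ is the union of the positive vectorial facets. Let $\Delta_{im}\subset V^*\setminus\{0\}$ be a set of imaginary roots, disjoint from $\mathbb R\Phi$ and stable under $\pm W^v$, in the moderately imaginary case: with $\Delta_{im}^+=\Delta_{im}\cap\sum_i\mathbb R_{\ge0}\alpha_i$, one has $\Delta_{im}=\Delta_{im}^+\cup-\Delta_{im}^+$, and $\Delta_{im}^+$ is $W^v$-stable. Put $\Delta=\Phi\cup\Delta_{im}$. **Model apartment.** Let $\mathbb A$ be an affine space under $V$, identified with $V$ by the choice of an origin, with a set $\mathcal M$ of walls, each of the form $M(\alpha,k)=\{\alpha+k=0\}$ with $\alpha\in\Phi$, $k\in\mathbb R$. Put $\Gamma_\alpha=\{k\mid M(\alpha,k)\in\mathcal M\}$ for $\alpha\in\Phi$ and $\Gamma_\alpha=\mathbb R$ for $\alpha\in\Delta_{im}$.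 Assume that $\Gamma_\alpha$ is infinite for $\alpha\in\Phi$ and that the group $W$ generated by the reflections $v\mapsto v-(\alpha(v)+k)\alpha^\vee$ in the walls stabilizes $\mathcal M$. Let $D(\alpha,k)=\{\alpha+k\ge0\}$, $D^\circ(\alpha,k)=\{\alpha+k>0\}$ and $D(\alpha,\infty)=\mathbb A$. A set $\Omega$ contains a filter $F$ if $\Omega\in F$; a subset is identified with the filter of the sets containing it; $F\cup F'$ is the filter of the sets belonging to both $F$ and $F'$; a map fixes $F$ if it fixes some element of $F$ pointwise. * The enclosure $cl(F)$ of a filter $F$ consists of the sets containing some element of $F$ of the form $\bigcap_{\alpha\in\Delta}D(\alpha,k_\alpha)$, $k_\alpha\in\Gamma_\alpha\cup\{\infty\}$. * For $x\in\mathbb A$ and a vectorial facet $F_0^v$, the facet $F(x,F_0^v)$ consists of the sets containing an intersection of half-spaces, one half-space $D(\alpha,k_\alpha)$ or $D^\circ(\alpha,k_\alpha)$ with $k_\alpha\in\Gamma_\alpha\cup\{\infty\}$ for each $\alpha\in\Delta$, that contains a neighbourhood of $x$ in $x+F_0^v$. * The chimney with base a facet $F$ and direction a vectorial facet $F^v$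 is $cl(F+F^v)$. Its germ consists of the sets containing $cl(F+\xi+F^v)$ for some $\xi\in\overline{F^v}$. It (and its germ) is splayed if $F^v$ is spherical, and solid if the direction of the smallest affine subspace containing it has a finite pointwise stabilizer in $W^v$. * A preordered interval germ is the germ at $x$ of $]x,y]$, where $x\ne y$ and $y-x\in\pm\mathcal T$. A generic half-line is $x+\mathbb R_{\ge0}v$ with $v\ne0$ in a spherical vectorial facet. * The sector germ of direction a vectorial chamber $C^v$ is the filter $germ_\infty(C^v)$ of the sets containing a translate of $C^v$. **Affine hovels.** An affine hovel of type $\mathbb A$ is a non-empty set $\mathcal I$ covered by a set $\mathcal A$ of subsets (apartments), such that: * (MA1) Each $A\in\mathcal A$ carries a non-empty set $Isom(\mathbb A,A)$ of bijections $\mathbb A\to A$ that is a single orbit $f_0\circ W$. An isomorphism $\varphi:A\to A'$ of apartments is a bijection with $\varphi\circ f\in Isom(\mathbb A,A')$ for $f\in Isom(\mathbb A,A)$, and the notions above are transported to $A$. * (MA2) If $F$ is a point, a preordered interval germ, a generic half-line or a solid chimney of $A$, and $A'$ is an apartment containing $F$, then $A\cap A'$ contains $cl_A(F)$ and there is an isomorphism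 $A\to A'$ fixing $cl_A(F)$. * (MA3) If $\mathfrak R$ is a splayed chimney germ and $F$ a facet or a solid chimney germ (possibly in different apartments), then some apartment contains both. * (MA4) If two apartments $A,A'$ contain $\mathfrak R$ and $F$ as in (MA3), then $A\cap A'$ contains $cl_A(\mathfrak R\cup F)$ and there is an isomorphism $A\to A'$ fixing $cl_A(\mathfrak R\cup F)$. The sector germs of sign $\varepsilon$ of $\mathcal I$ are the filters $f(germ_\infty(\varepsilon wC^v_f))$ on $\mathcal I$, for $A\in\mathcal A$, $f\in Isom(\mathbb A,A)$, $w\in W^v$; they are the chambers of $\mathcal I^{+\infty}$ ($\varepsilon=+1$) and of $\mathcal I^{-\infty}$ ($\varepsilon=-1$). **Theorem.** Let $\mathcal I$ be an affine hovel. (1) Any two sector germs $\mathfrak Q_1,\mathfrak Q_2$ of signs $\varepsilon_1,\varepsilon_2\in\{\pm1\}$ are contained in a common apartment. For every apartment $A$ containing both and every $f\in Isom(\mathbb A,A)$, there are $w_1,w_2\in W^v$ with $\mathfrak Q_j=f(germ_\infty(\varepsilon_jw_jC^v_f))$, and $w_1^{-1}w_2\in W^v$ does not depend on the choices of $A,f,w_1,w_2$.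 Denote it by $d_+(\mathfrak Q_1,\mathfrak Q_2)$ if $\varepsilon_1=\varepsilon_2=+1$, by $d_-(\mathfrak Q_1,\mathfrak Q_2)$ if $\varepsilon_1=\varepsilon_2=-1$, and by $d_*(\mathfrak Q_1,\mathfrak Q_2)$ (the codistance) if $\varepsilon_1=-\varepsilon_2$. (2) $(\mathcal I^{+\infty},d_+)$ and $(\mathcal I^{-\infty},d_-)$ are buildings of type $(W^v,S)$, i.e. the sets of chambers are non-empty and, for $d=d_\pm$, all chambers $x,y,z$ and $s\in S$: $d(x,y)=1\Leftrightarrow x=y$; if $d(y,z)=s$ and $w=d(x,y)$, then $d(x,z)\in\{w,ws\}$, and $d(x,z)=ws$ if $\ell(ws)>\ell(w)$; and there is a $z$ with $d(y,z)=s$ and $d(x,z)=d(x,y)s$. (3) $d_*$ is a twinning of $(\mathcal I^{+\infty},d_+)$ and $(\mathcal I^{-\infty},d_-)$: for $\varepsilon\in\{+,-\}$, $x\in\mathcal I^{\varepsilon\infty}$, $y\in\mathcal I^{-\varepsilon\infty}$ chambers, $w=d_*(x,y)$ and $s\in S$, one has $d_*(y,x)=w^{-1}$; if $z\in\mathcal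 I^{-\varepsilon\infty}$ satisfies $d_{-\varepsilon}(y,z)=s$ and $\ell(ws)<\ell(w)$, then $d_*(x,z)=ws$; and there is a chamber $z\in\mathcal I^{-\varepsilon\infty}$ with $d_{-\varepsilon}(y,z)=s$ and $d_*(x,z)=ws$. -/

import Mathlib

open Filter Topology

noncomputable section

/-! ### Vectorial Weyl group, roots, vectorial facets -/

/-- Simple roots `α_i` (a free family in the dual) and simple coroots `α_i^∨`, with
`α_i(α_i^∨) = 2`. -/
structure RootBasis (V ι : Type*) [AddCommGroup V] [Module ℝ V] where
  root : ι → Module.Dual ℝ V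
  coroot : ι → V
  root_coroot_two : ∀ i, root i (coroot i) = 2
  linearIndependent_root : LinearIndependent ℝ root

namespace RootBasis

variable {V ι : Type*} [AddCommGroup V] [Module ℝ V] (B : RootBasis V ι)

/-- The simple reflection `r_i(v) = v - α_i(v) α_i^∨`. -/
def refl (i : ι) : V ≃ₗ[ℝ] V := Module.reflection (B.root_coroot_two i)

/-- The vectorial Weyl group `W^v`. -/
def weyl : Subgroup (V ≃ₗ[ℝ] V) := Subgroup.closure (Set.range B.refl)

theorem refl_mem (i : ι) : B.refl i ∈ B.weyl :=
  Subgroup.subset_closure (Set.mem_range_self i)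

/-- The simple reflection, as an element of `W^v`. -/
def simpleRefl (i : ι) : B.weyl := ⟨B.refl i, B.refl_mem i⟩

/-- The contragredient action of `GL(V)` on the dual: `(w α)(v) = α(w⁻¹ v)`. -/
def dualAct (w : V ≃ₗ[ℝ] V) (a : Module.Dual ℝ V) : Module.Dual ℝ V :=
  a.comp (w.symm : V →ₗ[ℝ] V)

/-- `a` is a real root `w(α_i)`, and `c` the corresponding coroot `w(α_i^∨)`; the reflection
`r_a = w r_i w⁻¹` is `v ↦ v - a(v) c`. -/
def IsRootPair (a : Module.Dual ℝ V) (c : V) : Prop :=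
  ∃ w ∈ B.weyl, ∃ i, a = dualAct w (B.root i) ∧ c = w (B.coroot i)

/-- The set `Φ` of real roots. -/
def roots : Set (Module.Dual ℝ V) := {a | ∃ w ∈ B.weyl, ∃ i, a = dualAct w (B.root i)}

/-- The cone `⨁ ℝ⁺ α_i` in the dual. -/
def posCone [Fintype ι] : Set (Module.Dual ℝ V) :=
  {a | ∃ c : ι → ℝ, (∀ i, 0 ≤ c i) ∧ a = ∑ i, c i • B.root i}

/-- The set `Φ⁺` of positive roots. -/
def posRoots [Fintype ι] : Set (Module.Dual ℝ V) := B.roots ∩ B.posCone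

/-- The standard vectorial facet `F^v(J)`; `F^v(∅)` is the fundamental chamber `C^v_f`. -/
def stdFacet (J : Set ι) : Set V :=
  {v | (∀ i ∈ J, B.root i v = 0) ∧ ∀ i ∉ J, 0 < B.root i v}

/-- The vectorial facet `ε w F^v(J)`, of sign `ε = ±1`. -/
def facet (ε : ℤˣ) (w : V ≃ₗ[ℝ] V) (J : Set ι) : Set V :=
  (fun v => ε • w v) '' B.stdFacet J

/-- The vectorial chamber `ε w C^v_f`. -/
def chamber (ε : ℤˣ) (w : V ≃ₗ[ℝ] V) : Set V := B.facet ε w ∅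

/-- `J` is spherical if the group generated by the `r_i`, `i ∈ J`, is finite. -/
def IsSphericalType (J : Set ι) : Prop :=
  (Subgroup.closure (B.refl '' J) : Set (V ≃ₗ[ℝ] V)).Finite

/-- Vectorial facets (positive or negative). -/
def IsVecFacet (F : Set V) : Prop :=
  ∃ ε : ℤˣ, ∃ w ∈ B.weyl, ∃ J : Set ι, F = B.facet ε w J

/-- Spherical vectorial facets (positive or negative). -/
def IsSphericalVecFacet (F : Set V) : Prop :=
  ∃ ε : ℤˣ, ∃ w ∈ B.weyl, ∃ J : Set ι, B.IsSphericalType J ∧ F = B.facet ε w J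

/-- The Tits cone: the union of the positive vectorial facets. -/
def titsCone : Set V := {v | ∃ w ∈ B.weyl, ∃ J : Set ι, v ∈ B.facet 1 w J}

end RootBasis

/-- The quadruple `(V, W^v, (α_i), (α_i^∨))` with its standing properties. -/
structure VectorialWeylData (V ι : Type*) [AddCommGroup V] [Module ℝ V] [Fintype ι]
    extends RootBasis V ι where
  /-- The Coxeter matrix of `W^v`. -/
  cox : CoxeterMatrix ι
  /-- `W^v`, with the generators `r_i`, is a Coxeter group. -/
  cs : CoxeterSystem cox toRootBasis.weyl
  cs_simple : ∀ i, cs.simple i = toRootBasis.simpleRefl i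
  cox_eq_orderOf : ∀ i j,
    cox.M i j = orderOf (toRootBasis.simpleRefl i * toRootBasis.simpleRefl j)
  /-- The reflection `r_α = w r_i w⁻¹` depends only on the root `α = w(α_i)`. -/
  refl_wellDefined : ∀ w ∈ toRootBasis.weyl, ∀ w' ∈ toRootBasis.weyl, ∀ i j,
    RootBasis.dualAct w (root i) = RootBasis.dualAct w' (root j) →
      w * toRootBasis.refl i * w⁻¹ = w' * toRootBasis.refl j * w'⁻¹
  /-- `Φ = Φ⁺ ⊔ Φ⁻` with `Φ⁻ = -Φ⁺`. -/
  roots_eq : toRootBasis.roots = toRootBasis.posRoots ∪ {a | -a ∈ toRootBasis.posRoots}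
  disjoint_roots : Disjoint toRootBasis.posRoots {a | -a ∈ toRootBasis.posRoots}
  eq_one_of_stabilizes : ∀ w ∈ toRootBasis.weyl,
    RootBasis.dualAct w '' toRootBasis.posRoots = toRootBasis.posRoots → w = 1
  pos_iff_length : ∀ (w : toRootBasis.weyl) (i : ι),
    RootBasis.dualAct (w : V ≃ₗ[ℝ] V) (root i) ∈ toRootBasis.posRoots ↔
      cs.length w < cs.length (w * toRootBasis.simpleRefl i)
  /-- `Φ ∩ ℝ⁺ α = {α}` for every real root `α`. -/
  root_multiple : ∀ a ∈ toRootBasis.roots, ∀ t : ℝ, 0 ≤ t → t • a ∈ toRootBasis.roots → t = 1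

/-! ### The model affine apartment -/

/-- The hyperplane `M(α, k) = {v | α(v) + k = 0}`. -/
def affineHyperplane {V : Type*} [AddCommGroup V] [Module ℝ V]
    (a : Module.Dual ℝ V) (k : ℝ) : Set V := {v | a v + k = 0}

/-- The model affine apartment `𝔸`, in the moderately imaginary case. An origin (not assumed to
be special) is chosen in the affine space, which is thus identified with `V`. -/
structure AffineApartment {V ι : Type*} [AddCommGroup V] [Module ℝ V] [Fintype ι]
    (D : VectorialWeylData V ι) where
  /-- The set `Δ_im` of imaginary roots. -/
  imRoots : Set (Module.Dual ℝ V)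
  zero_notMem_imRoots : (0 : Module.Dual ℝ V) ∉ imRoots
  imRoots_disjoint : ∀ a ∈ D.roots, ∀ t : ℝ, t • a ∉ imRoots
  imRoots_neg : ∀ a ∈ imRoots, -a ∈ imRoots
  imRoots_weyl : ∀ w ∈ D.weyl, ∀ a ∈ imRoots, RootBasis.dualAct w a ∈ imRoots
  /-- Moderately imaginary: `Δ_im = Δ_im⁺ ∪ -Δ_im⁺`, where `Δ_im⁺` consists of the imaginary
  roots in `⨁ ℝ⁺ α_i`, and `Δ_im⁺` is stable under `W^v`. -/
  imRoots_subset : ∀ a ∈ imRoots, a ∈ D.posCone ∨ -a ∈ D.posCone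
  imRoots_pos_weyl : ∀ w ∈ D.weyl, ∀ a ∈ imRoots ∩ D.posCone,
    RootBasis.dualAct w a ∈ imRoots ∩ D.posCone
  /-- The set of (real) walls. -/
  walls : Set (Set V)
  walls_direction : ∀ M ∈ walls, ∃ a ∈ D.roots, ∃ k : ℝ, M = affineHyperplane a k
  walls_infinite : ∀ a ∈ D.roots, {k : ℝ | affineHyperplane a k ∈ walls}.Infinite
  /-- The group generated by the reflections in the walls stabilizes the set of walls. -/
  walls_stable : ∀ g ∈ Subgroup.closure {g : V ≃ᵃ[ℝ] V | ∃ a c k, D.IsRootPair a c ∧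
      affineHyperplane a k ∈ walls ∧ ∀ v, g v = v - (a v + k) • c},
    ∀ M ∈ walls, g '' M ∈ walls

namespace AffineApartment

variable {V ι : Type*} [NormedAddCommGroup V] [NormedSpace ℝ V] [Fintype ι]
  {D : VectorialWeylData V ι} (𝔸 : AffineApartment D)

/-- The affine Weyl group `W`, generated by the reflections `r_M`, for `M` a wall. -/
def affWeyl : Subgroup (V ≃ᵃ[ℝ] V) :=
  Subgroup.closure {g : V ≃ᵃ[ℝ] V | ∃ a c k, D.IsRootPair a c ∧
    affineHyperplane a k ∈ 𝔸.walls ∧ ∀ v, g v = v - (a v + k) • c}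

/-- The set `Δ = Φ ∪ Δ_im` of all roots. -/
def allRoots : Set (Module.Dual ℝ V) := D.roots ∪ 𝔸.imRoots

/-- The set `Γ_α` of those `k` for which `M(α, k)` is a real or imaginary wall; all the
hyperplanes of direction `Ker α`, `α` imaginary, are imaginary walls. -/
def levels (a : Module.Dual ℝ V) : Set ℝ :=
  {k | a ∈ 𝔸.imRoots ∨ affineHyperplane a k ∈ 𝔸.walls}

/-- The half-spaces `D(α, k)` with `k ∈ Γ_α ∪ {∞}`. -/
def closedHalves (a : Module.Dual ℝ V) : Set (Set V) :=
  {H | H = Set.univ ∨ ∃ k ∈ 𝔸.levels a, H = {v | 0 ≤ a v + k}}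

/-- The half-spaces `D(α, k)` and `D°(α, k)` with `k ∈ Γ_α ∪ {∞}`. -/
def halves (a : Module.Dual ℝ V) : Set (Set V) :=
  {H | H ∈ 𝔸.closedHalves a ∨ ∃ k ∈ 𝔸.levels a, H = {v | 0 < a v + k}}

theorem closedHalves_inter (a : Module.Dual ℝ V) {H K : Set V}
    (hH : H ∈ 𝔸.closedHalves a) (hK : K ∈ 𝔸.closedHalves a) : H ∩ K ∈ 𝔸.closedHalves a := by
  rcases hH with rfl | ⟨k, hk, rfl⟩
  · simpa using hK
  rcases hK with rfl | ⟨l, hl, rfl⟩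
  · exact Or.inr ⟨k, hk, by simp⟩
  rcases le_total k l with h | h
  · refine Or.inr ⟨k, hk, ?_⟩
    ext v
    simp only [Set.mem_inter_iff, Set.mem_ofPred_eq]
    exact ⟨fun hv => hv.1, fun hv => ⟨hv, by linarith⟩⟩
  · refine Or.inr ⟨l, hl, ?_⟩
    ext v
    simp only [Set.mem_inter_iff, Set.mem_ofPred_eq]
    exact ⟨fun hv => hv.2, fun hv => ⟨by linarith, hv⟩⟩

theorem halves_inter (a : Module.Dual ℝ V) {H K : Set V}
    (hH : H ∈ 𝔸.halves a) (hK : K ∈ 𝔸.halves a) : H ∩ K ∈ 𝔸.halves a := by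
  have key : H ⊆ K ∨ K ⊆ H := by
    rcases hH with (rfl | ⟨k, hk, rfl⟩) | ⟨k, hk, rfl⟩
    · exact Or.inr (Set.subset_univ _)
    all_goals
      rcases hK with (rfl | ⟨l, hl, rfl⟩) | ⟨l, hl, rfl⟩
      · exact Or.inl (Set.subset_univ _)
      all_goals
        rcases lt_trichotomy k l with h | h | h
        · refine Or.inl fun v hv => ?_
          simp only [Set.mem_ofPred_eq] at hv ⊢
          linarith
        · subst h
          first
          | exact Or.inl fun v hv => by
              simp only [Set.mem_ofPred_eq] at hv ⊢
              linarith
          | exact Or.inr fun v hv => by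
              simp only [Set.mem_ofPred_eq] at hv ⊢
              linarith
        · refine Or.inr fun v hv => ?_
          simp only [Set.mem_ofPred_eq] at hv ⊢
          linarith
  rcases key with h | h
  · rwa [Set.inter_eq_left.mpr h]
  · rwa [Set.inter_eq_right.mpr h]

/-- The enclosure `cl(F)` of a filter: the sets containing an element of `F` of the form
`⋂_{α ∈ Δ} D(α, k_α)`, with `k_α ∈ Γ_α ∪ {∞}`. -/
def cl (F : Filter V) : Filter V where
  sets := {S | ∃ c : Module.Dual ℝ V → Set V, (∀ a ∈ 𝔸.allRoots, c a ∈ 𝔸.closedHalves a) ∧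
    (⋂ a ∈ 𝔸.allRoots, c a) ∈ F ∧ (⋂ a ∈ 𝔸.allRoots, c a) ⊆ S}
  univ_sets := ⟨fun _ => Set.univ, fun _ _ => Or.inl rfl, by simp, Set.subset_univ _⟩
  sets_of_superset := by
    rintro S T ⟨c, hc, hF, hS⟩ hST
    exact ⟨c, hc, hF, hS.trans hST⟩
  inter_sets := by
    rintro S T ⟨c, hc, hF, hS⟩ ⟨c', hc', hF', hT⟩
    refine ⟨fun a => c a ∩ c' a, fun a ha => 𝔸.closedHalves_inter a (hc a ha) (hc' a ha), ?_, ?_⟩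
    · filter_upwards [hF, hF'] with v h h'
      simp only [Set.mem_iInter, Set.mem_inter_iff] at h h' ⊢
      exact fun a ha => ⟨h a ha, h' a ha⟩
    · intro v hv
      simp only [Set.mem_iInter, Set.mem_inter_iff] at hv
      exact ⟨hS (by simpa using fun a ha => (hv a ha).1),
        hT (by simpa using fun a ha => (hv a ha).2)⟩

/-- The local facet `F^ℓ(x, F^v)`: the germ at `x` of `x + F^v`. -/
def localFacet (x : V) (Fv : Set V) : Filter V := 𝓝[(fun v => x + v) '' Fv] x

/-- The facet `F(x, F^v)`: the sets containing an intersection of half-spaces `D(α, k_α)` or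
`D°(α, k_α)` (a single one for each `α ∈ Δ`) that contains the local facet. -/
def affFacet (x : V) (Fv : Set V) : Filter V where
  sets := {S | ∃ c : Module.Dual ℝ V → Set V, (∀ a ∈ 𝔸.allRoots, c a ∈ 𝔸.halves a) ∧
    (⋂ a ∈ 𝔸.allRoots, c a) ∈ localFacet x Fv ∧ (⋂ a ∈ 𝔸.allRoots, c a) ⊆ S}
  univ_sets := ⟨fun _ => Set.univ, fun _ _ => Or.inl (Or.inl rfl), by simp, Set.subset_univ _⟩
  sets_of_superset := by
    rintro S T ⟨c, hc, hF, hS⟩ hST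
    exact ⟨c, hc, hF, hS.trans hST⟩
  inter_sets := by
    rintro S T ⟨c, hc, hF, hS⟩ ⟨c', hc', hF', hT⟩
    refine ⟨fun a => c a ∩ c' a, fun a ha => 𝔸.halves_inter a (hc a ha) (hc' a ha), ?_, ?_⟩
    · filter_upwards [hF, hF'] with v h h'
      simp only [Set.mem_iInter, Set.mem_inter_iff] at h h' ⊢
      exact fun a ha => ⟨h a ha, h' a ha⟩
    · intro v hv
      simp only [Set.mem_iInter, Set.mem_inter_iff] at hv
      exact ⟨hS (by simpa using fun a ha => (hv a ha).1),
        hT (by simpa using fun a ha => (hv a ha).2)⟩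

/-- The shortened chimney `cl(F + ξ + F^v)`, with `F = F(x, F₀^v)`. -/
def shortChimney (x : V) (F₀ Fv : Set V) (ξ : V) : Filter V :=
  𝔸.cl (Filter.map₂ (fun u v => u + v) (Filter.map (fun u => u + ξ) (𝔸.affFacet x F₀)) (𝓟 Fv))

/-- The chimney `𝔯(F, F^v) = cl(F + F^v)`, with base `F = F(x, F₀^v)` and direction `F^v`. -/
def chimney (x : V) (F₀ Fv : Set V) : Filter V :=
  𝔸.cl (Filter.map₂ (fun u v => u + v) (𝔸.affFacet x F₀) (𝓟 Fv))

/-- The germ of a chimney: the sets containing one of its shortenings `cl(F + ξ + F^v)`, `ξ` in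
the closure of `F^v` (these filters form a directed family). -/
def chimneyGerm (x : V) (F₀ Fv : Set V) : Filter V :=
  ⨅ ξ ∈ closure Fv, 𝔸.shortChimney x F₀ Fv ξ

/-- The support of a filter: the smallest affine subspace containing it. -/
def support (F : Filter V) : AffineSubspace ℝ V :=
  sInf {E : AffineSubspace ℝ V | (E : Set V) ∈ F}

/-- The chimney `𝔯(F, F^v)` is solid: the direction of its support has a finite pointwise
stabilizer in `W^v`. -/
def ChimneySolid (x : V) (F₀ Fv : Set V) : Prop :=
  {w : V ≃ₗ[ℝ] V | w ∈ D.weyl ∧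
    ∀ v ∈ (support (𝔸.chimney x F₀ Fv)).direction, w v = v}.Finite

/-- Facets of `𝔸`. -/
def IsFacet (F : Filter V) : Prop := ∃ x F₀, D.IsVecFacet F₀ ∧ F = 𝔸.affFacet x F₀

/-- Solid chimneys of `𝔸`. -/
def IsSolidChimney (F : Filter V) : Prop :=
  ∃ x F₀ Fv, D.IsVecFacet F₀ ∧ D.IsVecFacet Fv ∧ 𝔸.ChimneySolid x F₀ Fv ∧
    F = 𝔸.chimney x F₀ Fv

/-- Germs of solid chimneys of `𝔸`. -/
def IsSolidChimneyGerm (F : Filter V) : Prop :=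
  ∃ x F₀ Fv, D.IsVecFacet F₀ ∧ D.IsVecFacet Fv ∧ 𝔸.ChimneySolid x F₀ Fv ∧
    F = 𝔸.chimneyGerm x F₀ Fv

/-- Germs of splayed chimneys of `𝔸` (those with a spherical direction). -/
def IsSplayedChimneyGerm (R : Filter V) : Prop :=
  ∃ x F₀ Fv, D.IsVecFacet F₀ ∧ D.IsSphericalVecFacet Fv ∧ R = 𝔸.chimneyGerm x F₀ Fv

/-- Germs `]x, y)` of preordered intervals: `x ≠ y`, and `x ≤ y` or `y ≤ x`. -/
def IsPreorderedIntervalGerm (D : VectorialWeylData V ι) (F : Filter V) : Prop :=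
  ∃ x y : V, x ≠ y ∧ (y - x ∈ D.titsCone ∨ x - y ∈ D.titsCone) ∧
    F = 𝓝[(fun t : ℝ => x + t • (y - x)) '' Set.Ioc 0 1] x

/-- Generic half-lines: their direction lies in a spherical vectorial facet. -/
def IsGenericHalfLine (D : VectorialWeylData V ι) (F : Filter V) : Prop :=
  ∃ x v : V, v ≠ 0 ∧ (∃ Fv, D.IsSphericalVecFacet Fv ∧ v ∈ Fv) ∧
    F = 𝓟 ((fun t : ℝ => x + t • v) '' Set.Ici 0)

/-- The germ of the sectors of direction `C`: the sets containing a translate of `C` (for a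
vectorial chamber, the translates form a directed family). -/
def sectorGerm (C : Set V) : Filter V := ⨅ x : V, 𝓟 ((fun v => x + v) '' C)

end AffineApartment

/-! ### Affine hovels -/

/-- An affine hovel (masure affine) of type `𝔸` on the set `I`. An isomorphism from the apartment
`A` to the apartment `A'` is a map `φ` with `φ ∘ f ∈ isom A'` for `f ∈ isom A`; a filter of `A` is
handled through its inverse image `F` under a chart `f ∈ isom A`, a subset `A'` of `I` contains it
when `A' ∈ map f F`, and `φ` fixes it when `φ ∘ f` and `f` coincide on some element of `F`. -/
structure AffineHovel {V ι : Type*} [NormedAddCommGroup V] [NormedSpace ℝ V] [Fintype ι]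
    {D : VectorialWeylData V ι} (𝔸 : AffineApartment D) (I : Type*) where
  /-- The set of apartments. -/
  apts : Set (Set I)
  covering : ⋃₀ apts = Set.univ
  /-- The set `Isom(𝔸, A)`, for an apartment `A`. -/
  isom : Set I → Set (V → I)
  isom_nonempty : ∀ A ∈ apts, (isom A).Nonempty
  isom_bijOn : ∀ A ∈ apts, ∀ f ∈ isom A, Function.Injective f ∧ Set.range f = A
  isom_iff : ∀ A ∈ apts, ∀ f₀ ∈ isom A, ∀ f : V → I,
    f ∈ isom A ↔ ∃ w ∈ 𝔸.affWeyl, f = f₀ ∘ w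
  /-- (MA2) -/
  ma2 : ∀ A ∈ apts, ∀ f ∈ isom A, ∀ F : Filter V,
    ((∃ x, F = pure x) ∨ AffineApartment.IsPreorderedIntervalGerm D F ∨
      AffineApartment.IsGenericHalfLine D F ∨ 𝔸.IsSolidChimney F) →
    ∀ A' ∈ apts, A' ∈ map f F →
      A ∩ A' ∈ map f (𝔸.cl F) ∧
      ∃ φ : I → I, φ ∘ f ∈ isom A' ∧ ∀ᶠ x in 𝔸.cl F, φ (f x) = f x
  /-- (MA3) -/
  ma3 : ∀ A₁ ∈ apts, ∀ f₁ ∈ isom A₁, ∀ A₂ ∈ apts, ∀ f₂ ∈ isom A₂, ∀ R F : Filter V,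
    𝔸.IsSplayedChimneyGerm R → (𝔸.IsFacet F ∨ 𝔸.IsSolidChimneyGerm F) →
    ∃ A ∈ apts, A ∈ map f₁ R ∧ A ∈ map f₂ F
  /-- (MA4) -/
  ma4 : ∀ A ∈ apts, ∀ f ∈ isom A, ∀ R F : Filter V,
    𝔸.IsSplayedChimneyGerm R → (𝔸.IsFacet F ∨ 𝔸.IsSolidChimneyGerm F) →
    ∀ A' ∈ apts, A' ∈ map f R → A' ∈ map f F →
      A ∩ A' ∈ map f (𝔸.cl (R ⊔ F)) ∧
      ∃ φ : I → I, φ ∘ f ∈ isom A' ∧ ∀ᶠ x in 𝔸.cl (R ⊔ F), φ (f x) = f x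

namespace AffineHovel

variable {V ι : Type*} [NormedAddCommGroup V] [NormedSpace ℝ V] [Fintype ι]
  {D : VectorialWeylData V ι} {𝔸 : AffineApartment D} {I : Type*} (H : AffineHovel 𝔸 I)

/-- The germ `f(germ_∞(x + ε w C^v_f))`, a filter of subsets of the hovel. -/
def chartGerm (D : VectorialWeylData V ι) {I : Type*} (f : V → I) (ε : ℤˣ) (w : D.weyl) :
    Filter I :=
  map f (AffineApartment.sectorGerm (D.chamber ε (w : V ≃ₗ[ℝ] V)))

/-- The set of sector germs of sign `ε` of the hovel, i.e. the set of chambers of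
`I^{+∞}` (for `ε = 1`) or `I^{-∞}` (for `ε = -1`). -/
def SectorGerm (ε : ℤˣ) : Type _ :=
  {Q : Filter I // ∃ A ∈ H.apts, ∃ f ∈ H.isom A, ∃ w : D.weyl, Q = chartGerm D f ε w}

/-- In the apartment `A` and the chart `f ∈ Isom(𝔸, A)`, the sector germs `Q₁`, `Q₂` have the
directions `ε₁ w₁ C^v_f` and `ε₂ w₂ C^v_f`. -/
def ReadIn {ε₁ ε₂ : ℤˣ} (Q₁ : H.SectorGerm ε₁) (Q₂ : H.SectorGerm ε₂) (A : Set I) (f : V → I)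
    (w₁ w₂ : D.weyl) : Prop :=
  A ∈ H.apts ∧ f ∈ H.isom A ∧ Q₁.1 = chartGerm D f ε₁ w₁ ∧ Q₂.1 = chartGerm D f ε₂ w₂

open Classical in
/-- The element `w₁⁻¹ w₂` computed in some apartment containing both sector germs. -/
def relPos {ε₁ ε₂ : ℤˣ} (Q₁ : H.SectorGerm ε₁) (Q₂ : H.SectorGerm ε₂) : D.weyl :=
  if h : ∃ u : D.weyl, ∃ A f w₁ w₂, H.ReadIn Q₁ Q₂ A f w₁ w₂ ∧ u = w₁⁻¹ * w₂ then h.choose else 1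

/-- The `W^v`-distance `d_ε` on the sector germs of sign `ε`. -/
def dist (ε : ℤˣ) (Q₁ Q₂ : H.SectorGerm ε) : D.weyl := H.relPos Q₁ Q₂

/-- The codistance `d_*(Q₁, Q₂)`, for `Q₁` positive and `Q₂` negative. -/
def codistPosNeg (Q₁ : H.SectorGerm 1) (Q₂ : H.SectorGerm (-1)) : D.weyl := H.relPos Q₁ Q₂

/-- The codistance `d_*(Q₁, Q₂)`, for `Q₁` negative and `Q₂` positive. -/
def codistNegPos (Q₁ : H.SectorGerm (-1)) (Q₂ : H.SectorGerm 1) : D.weyl := H.relPos Q₁ Q₂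

end AffineHovel

/-! ### Buildings and twinnings -/

section Buildings

variable {ι W : Type*} [Group W] {M : CoxeterMatrix ι} (cs : CoxeterSystem M W)

/-- `(C, d)` is a building of type `(W, S)`. -/
structure IsBuilding {C : Type*} (d : C → C → W) : Prop where
  nonempty : Nonempty C
  eq_one_iff : ∀ x y, d x y = 1 ↔ x = y
  adjacent : ∀ x y z i, d y z = cs.simple i →
    (d x z = d x y ∨ d x z = d x y * cs.simple i) ∧
    (cs.length (d x y) < cs.length (d x y * cs.simple i) → d x z = d x y * cs.simple i)
  exists_adjacent : ∀ x y i, ∃ z, d y z = cs.simple i ∧ d x z = d x y * cs.simple i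

/-- The second and third axioms of twinnings, for `x ∈ C` and `y, z ∈ C'`. -/
structure IsHalfTwinning {C C' : Type*} (d' : C' → C' → W) (δ : C → C' → W) : Prop where
  adjacent : ∀ x y z i, d' y z = cs.simple i →
    cs.length (δ x y * cs.simple i) < cs.length (δ x y) → δ x z = δ x y * cs.simple i
  exists_adjacent : ∀ x y i, ∃ z, d' y z = cs.simple i ∧ δ x z = δ x y * cs.simple i

/-- The codistance, given by `δ` on `C × C'` and by `δ'` on `C' × C`, is a twinning between the
buildings `(C, d)` and `(C', d')`. -/
structure IsTwinning {C C' : Type*} (d : C → C → W) (d' : C' → C' → W)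
    (δ : C → C' → W) (δ' : C' → C → W) : Prop where
  building : IsBuilding cs d
  building' : IsBuilding cs d'
  symm : ∀ x y, δ' y x = (δ x y)⁻¹
  half : IsHalfTwinning cs d' δ
  half' : IsHalfTwinning cs d δ'

end Buildings

end

noncomputable section

/-! Sector germs are germs of chimneys that are both splayed and solid. So (MA3) puts any two of
them in one apartment, and (MA4) compares two such apartments by an isomorphism fixing both germs. A
change of chart multiplies both directions on the left by the same element of W^v, hence w₁⁻¹w₂ is
well defined (`ReadIn.unique`). Inversion, separation and the existence of adjacent chambers are
then read in a single apartment. The remaining axioms, for distances and codistance alike, reduce to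
`relPos_adjacent`, which compares the positions of Q₁ and Q₂ relative to Q when Q₁ and Q₂ share a
panel.

The tool is the projection of Q onto the panel. A chimney germ in the direction of the panel is
splayed, so some apartment contains it together with Q; let Y be the sector germ of this apartment
that dominates the panel on the side of Q. The enclosure of the chimney germ and Q contains Y
(`sectorGerm_le_cl`), so Y does not depend on the apartment (`IsProj.unique`).

The projection must also be independent of the base point of the chimney: an apartment through Q and
Q₁ is only known to contain the chimney germs based far enough on the side of Q₁, and one through Q
and Q₂ those based far enough on the other side. A set in the germ of the chimney based on an alcove
at p lies in the germs of the chimneys based at p + τu, for small τ ≥ 0 and u in the direction of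
the alcove (`mem_chimneyGerm_add_smul`). With the alcoves in the directions of u and -u, the
projection is locally constant along ℝu, hence constant (`exists_forall_isProj_eq`).

Thus Q₁ and Q₂ have the same projection Y, which equals at most one of them. The position of each
relative to Q is that of Y if it equals Y, and that of Y times s otherwise. The position of Y is the
shorter of these two when the signs agree and the longer when they differ, which yields the building
axioms in one case and the twinning axioms in the other. -/

theorem LinearIndependent.exists_forall_dual_apply_eq {V ι : Type*} [AddCommGroup V] [Module ℝ V]
    [FiniteDimensional ℝ V] {r : ι → Module.Dual ℝ V} (h : LinearIndependent ℝ r) (c : ι → ℝ) :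
    ∃ v, ∀ j, r j v = c j := by
  obtain ⟨φ, hφ⟩ : ∃ φ : Module.Dual ℝ (Module.Dual ℝ V), ∀ j, φ (r j) = c j := by
    obtain ⟨g, hg⟩ := LinearMap.exists_extend ((Module.Basis.span h).constr ℝ c)
    refine ⟨g, fun j => ?_⟩
    have h1 : ((Module.Basis.span h) j : Module.Dual ℝ V) = r j := by
      rw [Module.Basis.span_apply h j]
    have h2 : (g ∘ₗ (Submodule.span ℝ (Set.range r)).subtype) (Module.Basis.span h j) = c j := by
      rw [hg, Module.Basis.constr_basis]
    rw [← h1]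
    exact h2
  exact ⟨(Module.evalEquiv ℝ V).symm φ, fun j => by rw [← hφ j]; simp⟩

theorem Int.units_smul_eq_real_smul {V : Type*} [AddCommGroup V] [Module ℝ V] (ε : ℤˣ) (v : V) :
    ε • v = ((ε : ℤ) : ℝ) • v := by
  rcases Int.units_eq_one_or ε with rfl | rfl <;> simp

theorem Int.units_cast_mul_self (ε : ℤˣ) : ((ε : ℤ) : ℝ) * ((ε : ℤ) : ℝ) = 1 := by
  rcases Int.units_eq_one_or ε with rfl | rfl <;> simp

/-! ### Real roots, coroots and reflections. -/

namespace RootBasis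

variable {V ι : Type*} [AddCommGroup V] [Module ℝ V]

@[simp] theorem dualAct_apply (w : V ≃ₗ[ℝ] V) (a : Module.Dual ℝ V) (v : V) :
    dualAct w a v = a (w⁻¹ v) := rfl

theorem dualAct_mul (w w' : V ≃ₗ[ℝ] V) (a : Module.Dual ℝ V) :
    dualAct (w * w') a = dualAct w (dualAct w' a) := by
  ext v
  simp [mul_inv_rev]

theorem dualAct_neg (w : V ≃ₗ[ℝ] V) (a : Module.Dual ℝ V) : dualAct w (-a) = -dualAct w a := rfl

theorem refl_apply (B : RootBasis V ι) (i : ι) (v : V) :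
    B.refl i v = v - B.root i v • B.coroot i := Module.reflection_apply _ _

theorem refl_inv (B : RootBasis V ι) (i : ι) : (B.refl i)⁻¹ = B.refl i := by
  rw [inv_eq_iff_mul_eq_one]
  ext v
  exact Module.involutive_reflection (B.root_coroot_two i) v

theorem dualAct_refl_self (B : RootBasis V ι) (i : ι) :
    dualAct (B.refl i) (B.root i) = -B.root i := by
  ext v
  rw [dualAct_apply, refl_inv, refl_apply, map_sub, map_smul, B.root_coroot_two]
  simp only [smul_eq_mul, LinearMap.neg_apply]
  ring

theorem simpleRefl_mul_self (B : RootBasis V ι) (i : ι) : B.simpleRefl i * B.simpleRefl i = 1 := by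
  have h : B.refl i * B.refl i = 1 := by
    conv_lhs => enter [1]; rw [← B.refl_inv i]
    exact inv_mul_cancel _
  exact Subtype.ext h

@[simp] theorem coe_simpleRefl (B : RootBasis V ι) (i : ι) :
    (B.simpleRefl i : V ≃ₗ[ℝ] V) = B.refl i := rfl

theorem dualAct_mem_roots (B : RootBasis V ι) {w : V ≃ₗ[ℝ] V} (hw : w ∈ B.weyl)
    {a : Module.Dual ℝ V} (ha : a ∈ B.roots) : dualAct w a ∈ B.roots := by
  obtain ⟨w', hw', i, rfl⟩ := ha
  exact ⟨w * w', mul_mem hw hw', i, (dualAct_mul _ _ _).symm⟩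

theorem root_mem_roots (B : RootBasis V ι) (i : ι) : B.root i ∈ B.roots :=
  ⟨1, one_mem _, i, rfl⟩

theorem neg_mem_roots (B : RootBasis V ι) {a : Module.Dual ℝ V} (ha : a ∈ B.roots) :
    -a ∈ B.roots := by
  obtain ⟨w, hw, i, rfl⟩ := ha
  refine ⟨w * B.refl i, mul_mem hw (B.refl_mem i), i, ?_⟩
  rw [dualAct_mul, dualAct_refl_self, dualAct_neg]

theorem exists_coroot (B : RootBasis V ι) {a : Module.Dual ℝ V} (ha : a ∈ B.roots) :
    ∃ c, B.IsRootPair a c := by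
  obtain ⟨w, hw, i, rfl⟩ := ha
  exact ⟨w (B.coroot i), w, hw, i, rfl, rfl⟩

theorem IsRootPair.apply_eq_two {B : RootBasis V ι} {a : Module.Dual ℝ V} {c : V}
    (h : B.IsRootPair a c) : a c = 2 := by
  obtain ⟨w, hw, i, rfl, rfl⟩ := h
  rw [dualAct_apply, ← LinearEquiv.mul_apply, inv_mul_cancel]
  exact B.root_coroot_two i

theorem ne_zero_of_mem_roots (B : RootBasis V ι) {a : Module.Dual ℝ V} (ha : a ∈ B.roots) :
    a ≠ 0 := by
  rintro rfl
  obtain ⟨c, hc⟩ := B.exists_coroot ha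
  simpa using hc.apply_eq_two

/-- The reflection in a root lies in the Weyl group. -/
theorem IsRootPair.exists_mem_weyl {B : RootBasis V ι} {a : Module.Dual ℝ V} {c : V}
    (h : B.IsRootPair a c) : ∃ w ∈ B.weyl, ∀ v, w v = v - a v • c := by
  obtain ⟨w, hw, i, rfl, rfl⟩ := h
  refine ⟨w * B.refl i * w⁻¹, mul_mem (mul_mem hw (B.refl_mem i)) (inv_mem hw), fun v => ?_⟩
  have h1 : w (w⁻¹ v) = v := by rw [← LinearEquiv.mul_apply, mul_inv_cancel]; rfl
  rw [LinearEquiv.mul_apply, LinearEquiv.mul_apply, refl_apply, map_sub, map_smul, h1,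
    dualAct_apply]

end RootBasis

/-! ### Chambers, panels and lengths in the vectorial Weyl group. -/

namespace VectorialWeylData

open RootBasis

variable {V ι : Type*} [AddCommGroup V] [Module ℝ V] [Fintype ι] (D : VectorialWeylData V ι)

theorem root_pos_of_mem_posRoots {a : Module.Dual ℝ V} (ha : a ∈ D.posRoots) {v : V}
    (hv : ∀ j, 0 < D.root j v) : 0 < a v := by
  obtain ⟨har, c, hc, rfl⟩ := ha
  have hne := D.ne_zero_of_mem_roots har
  obtain ⟨j, -, hj⟩ : ∃ j ∈ Finset.univ, c j • D.root j ≠ 0 := by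
    by_contra! h
    exact hne (Finset.sum_eq_zero h)
  have hcj : 0 < c j := lt_of_le_of_ne (hc j) fun h => hj (by rw [← h, zero_smul])
  simp only [LinearMap.sum_apply, LinearMap.smul_apply, smul_eq_mul]
  exact Finset.sum_pos' (fun k _ => mul_nonneg (hc k) (hv k).le)
    ⟨j, Finset.mem_univ _, mul_pos hcj (hv j)⟩

theorem root_nonneg_of_mem_posRoots {a : Module.Dual ℝ V} (ha : a ∈ D.posRoots) {v : V}
    (hv : ∀ j, 0 ≤ D.root j v) : 0 ≤ a v := by
  obtain ⟨har, c, hc, rfl⟩ := ha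
  simp only [LinearMap.sum_apply, LinearMap.smul_apply, smul_eq_mul]
  exact Finset.sum_nonneg fun k _ => mul_nonneg (hc k) (hv k)

theorem mem_posRoots_or_neg {a : Module.Dual ℝ V} (ha : a ∈ D.roots) :
    a ∈ D.posRoots ∨ -a ∈ D.posRoots := by
  have h := D.roots_eq
  rw [h] at ha
  exact ha

theorem mem_posRoots_of_pos {a : Module.Dual ℝ V} (ha : a ∈ D.roots) {v : V}
    (hv : ∀ j, 0 ≤ D.root j v) (hav : 0 < a v) : a ∈ D.posRoots := by
  refine (D.mem_posRoots_or_neg ha).resolve_right fun h => ?_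
  have := D.root_nonneg_of_mem_posRoots h hv
  simp only [LinearMap.neg_apply] at this
  linarith

/-- A nontrivial element has a right descent `j`, and by the length criterion it then sends α_j to a
root that is not positive. -/
theorem eq_one_of_forall_mem_posRoots {u : D.weyl}
    (h : ∀ j, dualAct (u : V ≃ₗ[ℝ] V) (D.root j) ∈ D.posRoots) : u = 1 := by
  by_contra hu
  obtain ⟨j, hj⟩ := D.cs.exists_rightDescent_of_ne_one hu
  have h1 := (D.pos_iff_length u j).1 (h j)
  rw [CoxeterSystem.IsRightDescent, D.cs_simple] at hj
  exact lt_asymm h1 hj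

/-- The root `ε w α_j`. -/
def signedRoot (ε : ℤˣ) (w : D.weyl) (j : ι) : Module.Dual ℝ V :=
  ((ε : ℤ) : ℝ) • dualAct (w : V ≃ₗ[ℝ] V) (D.root j)

theorem signedRoot_apply (ε : ℤˣ) (w : D.weyl) (j : ι) (v : V) :
    D.signedRoot ε w j v = ((ε : ℤ) : ℝ) * D.root j ((w : V ≃ₗ[ℝ] V)⁻¹ v) := rfl

theorem signedRoot_neg (ε : ℤˣ) (w : D.weyl) (j : ι) (v : V) :
    D.signedRoot (-ε) w j v = -D.signedRoot ε w j v := by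
  simp [signedRoot_apply]

theorem signedRoot_apply_smul (ε : ℤˣ) (w : D.weyl) (j : ι) (v : V) :
    D.signedRoot ε w j (((ε : ℤ) : ℝ) • (w : V ≃ₗ[ℝ] V) v) = D.root j v := by
  rw [signedRoot_apply, map_smul, map_smul, ← LinearEquiv.mul_apply, inv_mul_cancel, smul_eq_mul,
    ← mul_assoc, Int.units_cast_mul_self, one_mul]
  rfl

theorem smul_apply_smul_inv (ε : ℤˣ) (w : D.weyl) (v : V) :
    ((ε : ℤ) : ℝ) • (w : V ≃ₗ[ℝ] V) (((ε : ℤ) : ℝ) • (w : V ≃ₗ[ℝ] V)⁻¹ v) = v := by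
  rw [map_smul, smul_smul, Int.units_cast_mul_self, one_smul, ← LinearEquiv.mul_apply,
    mul_inv_cancel]
  rfl

theorem mem_facet_iff {ε : ℤˣ} {w : D.weyl} {J : Set ι} {v : V} :
    v ∈ D.facet ε w J ↔
      (∀ j ∈ J, D.signedRoot ε w j v = 0) ∧ ∀ j ∉ J, 0 < D.signedRoot ε w j v := by
  constructor
  · rintro ⟨u, hu, rfl⟩
    simp only [Int.units_smul_eq_real_smul, signedRoot_apply_smul]
    exact hu
  · intro h
    refine ⟨((ε : ℤ) : ℝ) • (w : V ≃ₗ[ℝ] V)⁻¹ v, ?_, ?_⟩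
    · rw [← D.smul_apply_smul_inv ε w v] at h
      simp only [signedRoot_apply_smul] at h
      exact h
    · simp only [Int.units_smul_eq_real_smul, smul_apply_smul_inv]

theorem mem_chamber_iff {ε : ℤˣ} {w : D.weyl} {v : V} :
    v ∈ D.chamber ε w ↔ ∀ j, 0 < D.signedRoot ε w j v := by
  rw [RootBasis.chamber, mem_facet_iff]
  simp

/-- Freeness of the simple roots allows arbitrary prescribed values. This is the source of the
points of chambers and panels and of the vectors shortening chimneys. -/
theorem exists_signedRoot_apply_eq [FiniteDimensional ℝ V] (ε : ℤˣ) (w : D.weyl) (c : ι → ℝ) :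
    ∃ v, ∀ j, D.signedRoot ε w j v = c j := by
  obtain ⟨v, hv⟩ := D.linearIndependent_root.exists_forall_dual_apply_eq c
  exact ⟨((ε : ℤ) : ℝ) • (w : V ≃ₗ[ℝ] V) v, fun j => by rw [signedRoot_apply_smul, hv]⟩

theorem signedRoot_injective [FiniteDimensional ℝ V] (ε : ℤˣ) (w : D.weyl) :
    Function.Injective (D.signedRoot ε w) := by
  classical
  intro j k h
  obtain ⟨v, hv⟩ := D.exists_signedRoot_apply_eq ε w (Pi.single j 1)
  by_contra hjk
  have h1 := hv j
  rw [h, hv k, Pi.single_eq_same, Pi.single_eq_of_ne (Ne.symm hjk)] at h1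
  exact zero_ne_one h1

theorem exists_mem_chamber [FiniteDimensional ℝ V] (ε : ℤˣ) (w : D.weyl) :
    ∃ v, v ∈ D.chamber ε w := by
  obtain ⟨v, hv⟩ := D.exists_signedRoot_apply_eq ε w 1
  exact ⟨v, D.mem_chamber_iff.2 fun j => by rw [hv]; exact one_pos⟩

theorem exists_mem_facet [FiniteDimensional ℝ V] (ε : ℤˣ) (w : D.weyl) (J : Set ι) :
    ∃ v, v ∈ D.facet ε w J := by
  classical
  obtain ⟨v, hv⟩ := D.exists_signedRoot_apply_eq ε w fun j => if j ∈ J then 0 else 1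
  exact ⟨v, D.mem_facet_iff.2 ⟨fun j hj => by rw [hv, if_pos hj],
    fun j hj => by rw [hv, if_neg hj]; exact one_pos⟩⟩

theorem signedRoot_mem_roots (ε : ℤˣ) (w : D.weyl) (j : ι) : D.signedRoot ε w j ∈ D.roots := by
  have h := D.dualAct_mem_roots w.2 (D.root_mem_roots j)
  rcases Int.units_eq_one_or ε with rfl | rfl
  · simpa [signedRoot] using h
  · have h1 := D.neg_mem_roots h
    convert h1 using 1
    ext v
    simp [signedRoot_apply]

theorem smul_mem_facet {ε : ℤˣ} {w : D.weyl} {J : Set ι} {v : V} (hv : v ∈ D.facet ε w J)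
    {t : ℝ} (ht : 0 < t) : t • v ∈ D.facet ε w J := by
  rw [mem_facet_iff] at hv ⊢
  simp only [map_smul, smul_eq_mul]
  exact ⟨fun j hj => by rw [hv.1 j hj, mul_zero], fun j hj => mul_pos ht (hv.2 j hj)⟩

/-- A Weyl group element is determined by the chamber it defines. -/
theorem eq_of_mem_chamber {ε : ℤˣ} {w w' : D.weyl} {v : V} (h : v ∈ D.chamber ε w)
    (h' : v ∈ D.chamber ε w') : w = w' := by
  rw [← inv_mul_eq_one, ← inv_inj, inv_one, mul_inv_rev, inv_inv]
  rw [mem_chamber_iff] at h h'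
  simp only [signedRoot_apply] at h h'
  refine D.eq_one_of_forall_mem_posRoots fun j => ?_
  refine D.mem_posRoots_of_pos (D.dualAct_mem_roots (w'⁻¹ * w).2 (D.root_mem_roots j))
    (v := ((ε : ℤ) : ℝ) • (w' : V ≃ₗ[ℝ] V)⁻¹ v) (fun k => ?_) ?_
  · rw [map_smul]; exact (h' k).le
  · convert h j using 1
    rw [map_smul, dualAct_apply, ← LinearEquiv.mul_apply, smul_eq_mul]
    congr 3
    simp

/-- The fixer of a panel is generated by the corresponding reflection. -/
theorem eq_one_or_eq_of_fixes_panel [FiniteDimensional ℝ V] {ε : ℤˣ} {w g : D.weyl} {i : ι}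
    (h : ∀ v ∈ D.facet ε w {i}, (g : V ≃ₗ[ℝ] V) v = v) :
    g = 1 ∨ g = w * D.simpleRefl i * w⁻¹ := by
  obtain ⟨v, hv⟩ := D.exists_mem_facet ε w {i}
  have hg := h v hv
  rw [mem_facet_iff] at hv
  set v₀ : V := ((ε : ℤ) : ℝ) • (w : V ≃ₗ[ℝ] V)⁻¹ v with hv₀
  have hroot : ∀ j, D.root j v₀ = D.signedRoot ε w j v := fun j => by
    rw [hv₀, map_smul, signedRoot_apply, smul_eq_mul]
  have hi : D.root i v₀ = 0 := by rw [hroot]; exact hv.1 i rfl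
  have hpos : ∀ j ≠ i, 0 < D.root j v₀ := fun j hj => by rw [hroot]; exact hv.2 j hj
  have hnn : ∀ j, 0 ≤ D.root j v₀ := fun j => by
    by_cases hj : j = i
    · rw [hj, hi]
    · exact (hpos j hj).le
  -- For j ≠ i, the root u α_j takes at v₀ = u v₀ the value α_j(v₀) > 0, so it is positive; only the
  -- sign of u α_i is in doubt, and a factor r_i corrects it.
  have key : ∀ u : D.weyl, (u : V ≃ₗ[ℝ] V) v₀ = v₀ →
      dualAct (u : V ≃ₗ[ℝ] V) (D.root i) ∈ D.posRoots → u = 1 := by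
    intro u hu hui
    refine D.eq_one_of_forall_mem_posRoots fun j => ?_
    by_cases hj : j = i
    · rwa [hj]
    refine D.mem_posRoots_of_pos (D.dualAct_mem_roots u.2 (D.root_mem_roots j)) hnn ?_
    have hu' : (u : V ≃ₗ[ℝ] V)⁻¹ v₀ = v₀ := by
      conv_lhs => rw [← hu]
      rw [← LinearEquiv.mul_apply, inv_mul_cancel]; rfl
    rw [dualAct_apply, hu']
    exact hpos j hj
  have hu : ((w⁻¹ * g * w : D.weyl) : V ≃ₗ[ℝ] V) v₀ = v₀ := by
    rw [hv₀]
    simp only [Subgroup.coe_mul, Subgroup.coe_inv, LinearEquiv.mul_apply, map_smul]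
    rw [← LinearEquiv.mul_apply (w : V ≃ₗ[ℝ] V), mul_inv_cancel, LinearEquiv.coe_one, id, hg]
  rcases D.mem_posRoots_or_neg
    (D.dualAct_mem_roots (w⁻¹ * g * w : D.weyl).2 (D.root_mem_roots i)) with h1 | h1
  · left
    have h2 := key _ hu h1
    rwa [mul_assoc, inv_mul_eq_one, eq_comm, mul_eq_right] at h2
  · right
    have h2 := key (w⁻¹ * g * w * D.simpleRefl i) ?_ ?_
    · have h3 : w⁻¹ * g * w = D.simpleRefl i := by
        rw [eq_inv_of_mul_eq_one_left h2, inv_eq_iff_mul_eq_one, D.simpleRefl_mul_self]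
      rw [← h3]
      group
    · rw [Subgroup.coe_mul, LinearEquiv.mul_apply, coe_simpleRefl, refl_apply, hi, zero_smul,
        sub_zero, hu]
    · rw [Subgroup.coe_mul, dualAct_mul, coe_simpleRefl, dualAct_refl_self, dualAct_neg]
      exact h1

theorem facet_mul_simpleRefl (ε : ℤˣ) (w : D.weyl) (i : ι) :
    D.facet ε ((w * D.simpleRefl i : D.weyl) : V ≃ₗ[ℝ] V) {i} = D.facet ε w {i} := by
  have h : ∀ v ∈ D.stdFacet {i}, D.refl i v = v := fun v hv => by
    rw [refl_apply, hv.1 i rfl, zero_smul, sub_zero]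
  ext v
  constructor
  all_goals
    rintro ⟨u, hu, rfl⟩
    refine ⟨u, hu, ?_⟩
    simp [h u hu]

theorem signedRoot_mul_simpleRefl_self (ε : ℤˣ) (w : D.weyl) (i : ι) (v : V) :
    D.signedRoot ε (w * D.simpleRefl i) i v = -D.signedRoot ε w i v := by
  rw [signedRoot, Subgroup.coe_mul, dualAct_mul, coe_simpleRefl, dualAct_refl_self, dualAct_neg,
    smul_neg]
  rfl

/-- The condition that the panel root `ε₂ w α_i` is positive on the chamber `ε₁ w₁ C`, in terms of
lengths. -/
theorem signedRoot_pos_of_length {ε₁ ε₂ : ℤˣ} {w₁ w : D.weyl} {i : ι}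
    (h : D.cs.length (w₁⁻¹ * w) < D.cs.length (w₁⁻¹ * w * D.simpleRefl i) ↔ ε₁ = ε₂) {v : V}
    (hv : v ∈ D.chamber ε₁ w₁) : 0 < D.signedRoot ε₂ w i v := by
  rw [← D.pos_iff_length] at h
  rw [mem_chamber_iff] at hv
  set v₀ : V := ((ε₁ : ℤ) : ℝ) • (w₁ : V ≃ₗ[ℝ] V)⁻¹ v with hv₀
  have hpos : ∀ j, 0 < D.root j v₀ := fun j => by
    rw [hv₀, map_smul]; exact hv j
  have hval : D.signedRoot ε₂ w i v = ((ε₂ : ℤ) : ℝ) * ((ε₁ : ℤ) : ℝ) *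
      dualAct ((w₁⁻¹ * w : D.weyl) : V ≃ₗ[ℝ] V) (D.root i) v₀ := by
    rw [hv₀, map_smul, smul_eq_mul, mul_assoc, ← mul_assoc ((ε₁ : ℤ) : ℝ),
      Int.units_cast_mul_self, one_mul, signedRoot_apply, dualAct_apply, ← LinearEquiv.mul_apply]
    congr 3
    simp
  rw [hval]
  by_cases hε : ε₁ = ε₂
  · subst hε
    rw [Int.units_cast_mul_self, one_mul]
    exact D.root_pos_of_mem_posRoots (h.2 rfl) hpos
  · have h1 := (D.mem_posRoots_or_neg (D.dualAct_mem_roots (w₁⁻¹ * w).2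
      (D.root_mem_roots i))).resolve_left fun h' => hε (h.1 h')
    have h2 := D.root_pos_of_mem_posRoots h1 hpos
    rw [LinearMap.neg_apply] at h2
    have h3 : ((ε₂ : ℤ) : ℝ) * ((ε₁ : ℤ) : ℝ) = -1 := by
      rcases Int.units_eq_one_or ε₁ with rfl | rfl <;> rcases Int.units_eq_one_or ε₂ with rfl | rfl <;>
        simp_all
    rw [h3]
    linarith

theorem length_lt_mul_simpleRefl_iff (u : D.weyl) (i : ι) :
    D.cs.length (u * D.simpleRefl i) < D.cs.length (u * D.simpleRefl i * D.simpleRefl i) ↔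
      ¬ D.cs.length u < D.cs.length (u * D.simpleRefl i) := by
  rw [mul_assoc, D.simpleRefl_mul_self, mul_one, ← D.cs_simple]
  rcases D.cs.length_mul_simple u i with h | h <;> omega

/-- Of the two chambers along a panel, one is on the side of the chamber ε₁w₁C: multiplication by
r_i on the right reverses the length inequality. The same reversal gives uniqueness in
`side_unique`. -/
theorem exists_side (ε₁ ε₂ : ℤˣ) (w₁ w₂ : D.weyl) (i : ι) :
    ∃ w : D.weyl, (w = w₂ ∨ w = w₂ * D.simpleRefl i) ∧
      (D.cs.length (w₁⁻¹ * w) < D.cs.length (w₁⁻¹ * w * D.simpleRefl i) ↔ ε₁ = ε₂) := by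
  by_cases h : D.cs.length (w₁⁻¹ * w₂) < D.cs.length (w₁⁻¹ * w₂ * D.simpleRefl i) ↔ ε₁ = ε₂
  · exact ⟨w₂, Or.inl rfl, h⟩
  · refine ⟨_, Or.inr rfl, ?_⟩
    rw [← mul_assoc, D.length_lt_mul_simpleRefl_iff]
    tauto

theorem side_unique {ε₁ ε₂ : ℤˣ} {w₁ w₂ w w' : D.weyl} {i : ι}
    (hw : w = w₂ ∨ w = w₂ * D.simpleRefl i) (hw' : w' = w₂ ∨ w' = w₂ * D.simpleRefl i)
    (h : D.cs.length (w₁⁻¹ * w) < D.cs.length (w₁⁻¹ * w * D.simpleRefl i) ↔ ε₁ = ε₂)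
    (h' : D.cs.length (w₁⁻¹ * w') < D.cs.length (w₁⁻¹ * w' * D.simpleRefl i) ↔ ε₁ = ε₂) :
    w = w' := by
  rcases hw with rfl | rfl <;> rcases hw' with rfl | rfl
  · rfl
  · rw [← mul_assoc, D.length_lt_mul_simpleRefl_iff] at h'
    tauto
  · rw [← mul_assoc, D.length_lt_mul_simpleRefl_iff] at h
    tauto
  · rfl

theorem simpleRefl_ne_one (i : ι) : D.simpleRefl i ≠ 1 := by
  intro h
  have := D.cs.length_simple i
  rw [D.cs_simple, h, CoxeterSystem.length_one] at this
  exact zero_ne_one this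

theorem finite_closure_refl_singleton (i : ι) : D.IsSphericalType {i} := by
  have h1 : D.refl i * D.refl i = 1 := congrArg Subtype.val (D.simpleRefl_mul_self i)
  have h2 : IsOfFinOrder (D.refl i) :=
    isOfFinOrder_iff_pow_eq_one.2 ⟨2, two_pos, by rw [pow_two, h1]⟩
  rw [RootBasis.IsSphericalType, Set.image_singleton, ← Subgroup.zpowers_eq_closure]
  exact finite_zpowers.2 h2

theorem finite_closure_refl_empty : D.IsSphericalType ∅ := by
  rw [RootBasis.IsSphericalType, Set.image_empty, Subgroup.closure_empty]
  exact Set.finite_singleton 1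

end VectorialWeylData
end

noncomputable section

/-! ### Topology of vectorial facets and their closures. -/

namespace VectorialWeylData

variable {V ι : Type*} [NormedAddCommGroup V] [NormedSpace ℝ V] [FiniteDimensional ℝ V] [Fintype ι]
  (D : VectorialWeylData V ι)

theorem isOpen_chamber (ε : ℤˣ) (w : D.weyl) : IsOpen (D.chamber ε w) := by
  have h : D.chamber ε w = ⋂ j, {v | 0 < D.signedRoot ε w j v} := by
    ext v
    simp [mem_chamber_iff]
  rw [h]
  exact isOpen_iInter_of_finite fun j =>
    isOpen_lt continuous_const (LinearMap.continuous_of_finiteDimensional _)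

theorem signedRoot_of_mem_closure_facet {ε : ℤˣ} {w : D.weyl} {J : Set ι} {v : V}
    (hv : v ∈ closure (D.facet ε w J)) :
    (∀ j ∈ J, D.signedRoot ε w j v = 0) ∧ ∀ j, 0 ≤ D.signedRoot ε w j v := by
  have hc : ∀ j, Continuous (D.signedRoot ε w j) := fun j =>
    LinearMap.continuous_of_finiteDimensional _
  constructor
  · intro j hj
    exact closure_minimal (fun u hu => (D.mem_facet_iff.1 hu).1 j hj)
      (isClosed_eq (hc j) continuous_const) hv
  · intro j
    refine closure_minimal (t := {u | 0 ≤ D.signedRoot ε w j u}) (fun u hu => ?_)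
      (isClosed_le continuous_const (hc j)) hv
    by_cases hj : j ∈ J
    · exact ((D.mem_facet_iff.1 hu).1 j hj).ge
    · exact ((D.mem_facet_iff.1 hu).2 j hj).le

theorem add_mem_facet {ε : ℤˣ} {w : D.weyl} {J : Set ι} {u v : V}
    (hu : u ∈ closure (D.facet ε w J)) (hv : v ∈ D.facet ε w J) : u + v ∈ D.facet ε w J := by
  obtain ⟨h1, h2⟩ := D.signedRoot_of_mem_closure_facet hu
  rw [mem_facet_iff] at hv ⊢
  simp only [map_add]
  exact ⟨fun j hj => by rw [h1 j hj, hv.1 j hj, add_zero],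
    fun j hj => add_pos_of_nonneg_of_pos (h2 j) (hv.2 j hj)⟩

theorem zero_mem_closure_facet (ε : ℤˣ) (w : D.weyl) (J : Set ι) :
    (0 : V) ∈ closure (D.facet ε w J) := by
  obtain ⟨v, hv⟩ := D.exists_mem_facet ε w J
  have h : Tendsto (fun t : ℝ => t • v) (𝓝[>] 0) (𝓝 0) := by
    have : Tendsto (fun t : ℝ => t • v) (𝓝 0) (𝓝 ((0 : ℝ) • v)) :=
      (continuous_id.smul continuous_const).tendsto 0
    rw [zero_smul] at this
    exact this.mono_left nhdsWithin_le_nhds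
  exact mem_closure_of_tendsto h
    (eventually_mem_nhdsWithin.mono fun t ht => D.smul_mem_facet hv ht)

theorem mem_closure_add_facet (x : V) (ε : ℤˣ) (w : D.weyl) (J : Set ι) :
    x ∈ closure ((fun v => x + v) '' D.facet ε w J) := by
  have := image_closure_subset_closure_image (continuous_const_add x)
    ⟨0, D.zero_mem_closure_facet ε w J, rfl⟩
  simpa only [add_zero] using this

end VectorialWeylData

namespace AffineApartment

variable {V ι : Type*} [NormedAddCommGroup V] [NormedSpace ℝ V] [Fintype ι]
  {D : VectorialWeylData V ι} (𝔸 : AffineApartment D)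

/-! ### Walls -/

theorem exists_affWeyl_reflection {a : Module.Dual ℝ V} {c : V} (h : D.IsRootPair a c) {k : ℝ}
    (hk : affineHyperplane a k ∈ 𝔸.walls) : ∃ g ∈ 𝔸.affWeyl, ∀ v, g v = v - (a v + k) • c := by
  have h2 := h.apply_eq_two
  refine ⟨(Module.reflection h2).toAffineEquiv.trans (AffineEquiv.constVAdd ℝ V (-(k • c))), ?_, ?_⟩
  · refine Subgroup.subset_closure ⟨a, c, k, h, hk, fun v => ?_⟩
    simp [Module.reflection_apply, add_smul]
    abel
  · intro v
    simp [Module.reflection_apply, add_smul]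
    abel

theorem two_mul_sub_mem_walls {a : Module.Dual ℝ V} (ha : a ∈ D.roots) {k l : ℝ}
    (hk : affineHyperplane a k ∈ 𝔸.walls) (hl : affineHyperplane a l ∈ 𝔸.walls) :
    affineHyperplane a (2 * k - l) ∈ 𝔸.walls := by
  obtain ⟨c, hc⟩ := D.exists_coroot ha
  have h2 := hc.apply_eq_two
  obtain ⟨g, hg, hgv⟩ := 𝔸.exists_affWeyl_reflection hc hk
  convert 𝔸.walls_stable g hg _ hl using 1
  have key : ∀ v, a (g v) = -a v - 2 * k := fun v => by
    rw [hgv, map_sub, map_smul, h2, smul_eq_mul]; ring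
  have hinv : ∀ v, g (g v) = v := fun v => by
    rw [hgv (g v), key, hgv v, sub_sub, ← add_smul]
    convert sub_zero v using 2
    convert zero_smul ℝ c using 2
    ring
  ext v
  constructor
  · intro hv
    refine ⟨g v, ?_, hinv v⟩
    simp only [affineHyperplane, Set.mem_ofPred_eq] at hv ⊢
    rw [key]; linarith
  · rintro ⟨u, hu, rfl⟩
    simp only [affineHyperplane, Set.mem_ofPred_eq] at hu ⊢
    rw [key]; linarith

/-- Reflecting each of two parallel walls in the next produces an arithmetic progression of walls,
so the levels of a real root are unbounded in both directions. -/
theorem add_nat_mul_mem_walls {a : Module.Dual ℝ V} (ha : a ∈ D.roots) {k l : ℝ}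
    (hk : affineHyperplane a k ∈ 𝔸.walls) (hl : affineHyperplane a l ∈ 𝔸.walls) (n : ℕ) :
    affineHyperplane a (k + n * (l - k)) ∈ 𝔸.walls := by
  suffices h : affineHyperplane a (k + n * (l - k)) ∈ 𝔸.walls ∧
      affineHyperplane a (k + (n + 1 : ℕ) * (l - k)) ∈ 𝔸.walls from h.1
  induction n with
  | zero => simpa using ⟨hk, hl⟩
  | succ n ih =>
    refine ⟨ih.2, ?_⟩
    convert 𝔸.two_mul_sub_mem_walls ha ih.2 ih.1 using 2
    push_cast
    ring

theorem exists_walls_ne {a : Module.Dual ℝ V} (ha : a ∈ D.roots) :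
    ∃ k l, k < l ∧ affineHyperplane a k ∈ 𝔸.walls ∧ affineHyperplane a l ∈ 𝔸.walls := by
  obtain ⟨k, hk, l, hl, hkl⟩ := (𝔸.walls_infinite a ha).nontrivial
  rcases lt_or_gt_of_ne hkl with h | h
  · exact ⟨k, l, h, hk, hl⟩
  · exact ⟨l, k, h, hl, hk⟩

theorem exists_level_gt {a : Module.Dual ℝ V} (ha : a ∈ D.roots) (t : ℝ) :
    ∃ k ∈ 𝔸.levels a, t < k := by
  obtain ⟨k, l, hkl, hk, hl⟩ := 𝔸.exists_walls_ne ha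
  obtain ⟨n, hn⟩ := exists_nat_gt ((t - k) / (l - k))
  refine ⟨_, Or.inr (𝔸.add_nat_mul_mem_walls ha hk hl n), ?_⟩
  rw [div_lt_iff₀ (sub_pos.2 hkl)] at hn
  linarith

theorem exists_level_lt {a : Module.Dual ℝ V} (ha : a ∈ D.roots) (t : ℝ) :
    ∃ k ∈ 𝔸.levels a, k < t := by
  obtain ⟨k, l, hkl, hk, hl⟩ := 𝔸.exists_walls_ne ha
  obtain ⟨n, hn⟩ := exists_nat_gt ((l - t) / (l - k))
  refine ⟨_, Or.inr (𝔸.add_nat_mul_mem_walls ha hl hk n), ?_⟩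
  rw [div_lt_iff₀ (sub_pos.2 hkl)] at hn
  linarith

theorem exists_weyl_eq_linear {g : V ≃ᵃ[ℝ] V} (hg : g ∈ 𝔸.affWeyl) :
    ∃ u : D.weyl, ∀ x v, g (x + v) = g x + (u : V ≃ₗ[ℝ] V) v := by
  suffices h : g.linear ∈ D.weyl by
    refine ⟨⟨g.linear, h⟩, fun x v => ?_⟩
    have := g.map_vadd x v
    simp only [vadd_eq_add] at this
    rw [add_comm x, this, add_comm]
  have hle : 𝔸.affWeyl ≤ D.weyl.comap AffineEquiv.linearHom := by
    rw [affWeyl, Subgroup.closure_le]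
    rintro g ⟨a, c, k, hac, -, hg⟩
    obtain ⟨w, hw, hwv⟩ := hac.exists_mem_weyl
    have h : g.linear = w := by
      ext v
      have := g.map_vadd 0 v
      simp only [vadd_eq_add, add_zero] at this
      rw [← sub_eq_iff_eq_add] at this
      change g.linear v = w v
      rw [← this, hg, hg, hwv, map_zero, add_smul, zero_add]
      abel
    change g.linear ∈ D.weyl
    rwa [h]
  exact hle hg

/-- With respect to any chamber, a root has coefficients of constant sign. -/
theorem exists_coeff_of_mem_allRoots {a : Module.Dual ℝ V} (ha : a ∈ 𝔸.allRoots) (ε : ℤˣ)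
    (w : D.weyl) : ∃ d : ι → ℝ, ((∀ j, 0 ≤ d j) ∨ ∀ j, d j ≤ 0) ∧
      ∀ v, a v = ∑ j, d j * D.signedRoot ε w j v := by
  have h1 : RootBasis.dualAct ((w⁻¹ : D.weyl) : V ≃ₗ[ℝ] V) a ∈ D.posCone ∨
      -RootBasis.dualAct ((w⁻¹ : D.weyl) : V ≃ₗ[ℝ] V) a ∈ D.posCone := by
    rcases ha with ha | ha
    · exact (D.mem_posRoots_or_neg (D.dualAct_mem_roots (w⁻¹).2 ha)).imp (fun h => h.2) fun h => h.2
    · exact 𝔸.imRoots_subset _ (𝔸.imRoots_weyl _ (w⁻¹).2 _ ha)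
  have h2 : ∃ d : ι → ℝ, ((∀ j, 0 ≤ d j) ∨ ∀ j, d j ≤ 0) ∧
      ∀ v, RootBasis.dualAct ((w⁻¹ : D.weyl) : V ≃ₗ[ℝ] V) a v = ∑ j, d j * D.root j v := by
    rcases h1 with ⟨c, hc, h⟩ | ⟨c, hc, h⟩
    · exact ⟨c, Or.inl hc, fun v => by rw [h]; simp⟩
    · refine ⟨fun j => -c j, Or.inr fun j => neg_nonpos.2 (hc j), fun v => ?_⟩
      rw [← neg_neg (RootBasis.dualAct _ a), h]
      simp
  obtain ⟨d, hd, h⟩ := h2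
  have h3 : ∀ v, a v = ∑ j, d j * D.root j ((w : V ≃ₗ[ℝ] V)⁻¹ v) := fun v => by
    rw [← h, RootBasis.dualAct_apply, ← LinearEquiv.mul_apply]
    simp
  rcases Int.units_eq_one_or ε with rfl | rfl
  · exact ⟨d, hd, fun v => by rw [h3]; simp [VectorialWeylData.signedRoot_apply]⟩
  · refine ⟨fun j => -d j, hd.symm.imp (fun h j => neg_nonneg.2 (h j))
      (fun h j => neg_nonpos.2 (h j)), fun v => ?_⟩
    rw [h3]
    simp [VectorialWeylData.signedRoot_apply]

/-! ### Filters of the apartment -/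

theorem le_cl (F : Filter V) : F ≤ 𝔸.cl F := by
  rintro S ⟨c, -, hF, hS⟩
  exact mem_of_superset hF hS

theorem mem_shortChimney {x ξ : V} {F₀ Fv S : Set V} :
    S ∈ 𝔸.shortChimney x F₀ Fv ξ ↔ ∃ c : Module.Dual ℝ V → Set V,
      (∀ a ∈ 𝔸.allRoots, c a ∈ 𝔸.closedHalves a) ∧
      (∃ U ∈ 𝔸.affFacet x F₀, ∀ u ∈ U, ∀ v ∈ Fv, u + ξ + v ∈ ⋂ a ∈ 𝔸.allRoots, c a) ∧
      (⋂ a ∈ 𝔸.allRoots, c a) ⊆ S := by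
  refine exists_congr fun c => and_congr_right fun _ => and_congr_left fun _ => ?_
  rw [mem_map₂_iff]
  constructor
  · rintro ⟨U, hU, T, hT, h⟩
    exact ⟨_, hU, fun u hu v hv => h ⟨u + ξ, hu, v, hT hv, rfl⟩⟩
  · rintro ⟨U, hU, h⟩
    refine ⟨_, image_mem_map hU, Fv, mem_principal_self _, ?_⟩
    rintro _ ⟨_, ⟨u, hu, rfl⟩, v, hv, rfl⟩
    exact h u hu v hv

theorem mem_affFacet_of_mem_nhds {x : V} {F₀ : Set V} {c : Module.Dual ℝ V → Set V}
    (hc : ∀ a ∈ 𝔸.allRoots, c a ∈ 𝔸.halves a) (h : (⋂ a ∈ 𝔸.allRoots, c a) ∈ 𝓝 x) :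
    (⋂ a ∈ 𝔸.allRoots, c a) ∈ 𝔸.affFacet x F₀ :=
  ⟨c, hc, mem_nhdsWithin_of_mem_nhds h, subset_rfl⟩

/-- Levels are unbounded below, so every translate of a chamber contains a cone of the same
direction bounded by true walls, which is a set that enclosures can detect. -/
theorem exists_levels_subset_add_chamber (ε : ℤˣ) (w : D.weyl) (q : V) :
    ∃ k : ι → ℝ, (∀ j, k j ∈ 𝔸.levels (D.signedRoot ε w j)) ∧
      ∀ v, (∀ j, 0 ≤ D.signedRoot ε w j v + k j) → v - q ∈ D.chamber ε w := by
  have hex : ∀ j, ∃ l ∈ 𝔸.levels (D.signedRoot ε w j), l < -D.signedRoot ε w j q := fun j =>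
    𝔸.exists_level_lt (D.signedRoot_mem_roots ε w j) _
  choose k hk hlt using hex
  refine ⟨k, hk, fun v hv => D.mem_chamber_iff.2 fun j => ?_⟩
  rw [map_sub]
  linarith [hv j, hlt j]

theorem isVecFacet_facet (ε : ℤˣ) (w : D.weyl) (J : Set ι) : D.IsVecFacet (D.facet ε w J) :=
  ⟨ε, w, w.2, J, rfl⟩

theorem tendsto_add_smul_nhdsGT (v u : V) :
    Tendsto (fun s : ℝ => v + s • u) (𝓝[>] 0) (𝓝 v) := by
  have h : Continuous fun s : ℝ => v + s • u := by fun_prop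
  have := h.tendsto 0
  simp only [zero_smul, add_zero] at this
  exact this.mono_left nhdsWithin_le_nhds

theorem isSplayed_panel (x : V) (ε ε' : ℤˣ) (w w' : D.weyl) (J : Set ι) (i : ι) :
    𝔸.IsSplayedChimneyGerm (𝔸.chimneyGerm x (D.facet ε w J) (D.facet ε' w' {i})) :=
  ⟨x, _, _, isVecFacet_facet ε w J, ⟨ε', w', w'.2, {i}, D.finite_closure_refl_singleton i, rfl⟩,
    rfl⟩

variable [FiniteDimensional ℝ V]

/-- The shortenings form a directed family: the closure of the direction is stable under addition
and its sum with the direction stays in the direction, so ξ + η shortens further than either ξ or η.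
-/
theorem mem_chimneyGerm {x : V} {F₀ S : Set V} {ε : ℤˣ} {w : D.weyl} {J : Set ι} :
    S ∈ 𝔸.chimneyGerm x F₀ (D.facet ε w J) ↔
      ∃ ξ ∈ closure (D.facet ε w J), S ∈ 𝔸.shortChimney x F₀ (D.facet ε w J) ξ := by
  refine mem_biInf_of_directed ?_ ⟨0, D.zero_mem_closure_facet ε w J⟩
  have hle : ∀ ξ, ∀ η ∈ closure (D.facet ε w J),
      𝔸.shortChimney x F₀ (D.facet ε w J) (ξ + η) ≤ 𝔸.shortChimney x F₀ (D.facet ε w J) ξ := by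
    intro ξ η hη S hS
    rw [mem_shortChimney] at hS ⊢
    obtain ⟨c, hc, ⟨U, hU, h⟩, hcS⟩ := hS
    refine ⟨c, hc, ⟨U, hU, fun u hu v hv => ?_⟩, hcS⟩
    rw [← add_assoc, add_assoc]
    exact h u hu _ (D.add_mem_facet hη hv)
  have hadd : ∀ ξ ∈ closure (D.facet ε w J), ∀ η ∈ closure (D.facet ε w J),
      ξ + η ∈ closure (D.facet ε w J) := fun ξ hξ η hη =>
    closure_mono (fun _ h => by
      obtain ⟨u, hu, rfl⟩ := h
      exact D.add_mem_facet hξ hu)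
      (image_closure_subset_closure_image (continuous_const_add ξ) ⟨η, hη, rfl⟩)
  intro ξ hξ η hη
  refine ⟨ξ + η, hadd ξ hξ η hη, hle ξ η hη, ?_⟩
  change 𝔸.shortChimney x F₀ (D.facet ε w J) (ξ + η) ≤ 𝔸.shortChimney x F₀ (D.facet ε w J) η
  rw [add_comm]
  exact hle η ξ hξ

theorem mem_sectorGerm {ε : ℤˣ} {w : D.weyl} {S : Set V} :
    S ∈ sectorGerm (D.chamber ε w) ↔ ∃ x, ∀ v ∈ D.chamber ε w, x + v ∈ S := by
  obtain ⟨u, hu⟩ := D.exists_mem_chamber ε w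
  have hu' := D.mem_chamber_iff.1 hu
  have hdir : Directed (· ≥ ·) fun x : V => 𝓟 ((fun v => x + v) '' D.chamber ε w) := by
    intro x y
    have hex : ∀ x : V, ∀ᶠ t : ℝ in atTop, ∀ j, 0 < D.signedRoot ε w j (t • u - x) := fun x => by
      rw [eventually_all]
      intro j
      filter_upwards [eventually_gt_atTop (D.signedRoot ε w j x / D.signedRoot ε w j u)] with t ht
      rw [div_lt_iff₀ (hu' j)] at ht
      rw [map_sub, map_smul, smul_eq_mul]
      linarith
    obtain ⟨t, htx, hty⟩ := ((hex x).and (hex y)).exists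
    refine ⟨t • u, ?_, ?_⟩
    all_goals
      simp only [ge_iff_le, le_principal_iff, mem_principal]
      rintro _ ⟨v, hv, rfl⟩
    · refine ⟨t • u - x + v, D.add_mem_facet (subset_closure (D.mem_chamber_iff.2 htx)) hv, ?_⟩
      dsimp only; abel
    · refine ⟨t • u - y + v, D.add_mem_facet (subset_closure (D.mem_chamber_iff.2 hty)) hv, ?_⟩
      dsimp only; abel
  rw [sectorGerm, mem_iInf_of_directed hdir]
  simp only [mem_principal, Set.image_subset_iff]
  rfl

instance sectorGerm_neBot (ε : ℤˣ) (w : D.weyl) : (sectorGerm (D.chamber ε w)).NeBot := by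
  rw [← forall_mem_nonempty_iff_neBot]
  intro S hS
  obtain ⟨x, hx⟩ := mem_sectorGerm.1 hS
  obtain ⟨v, hv⟩ := D.exists_mem_chamber ε w
  exact ⟨_, hx v hv⟩

theorem sectorGerm_injective {ε : ℤˣ} {w w' : D.weyl}
    (h : sectorGerm (D.chamber ε w) = sectorGerm (D.chamber ε w')) : w = w' := by
  have h1 : D.chamber ε w ∈ sectorGerm (D.chamber ε w) :=
    mem_sectorGerm.2 ⟨0, fun v hv => by rwa [zero_add]⟩
  have h2 : D.chamber ε w' ∈ sectorGerm (D.chamber ε w) := by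
    rw [h]
    exact mem_sectorGerm.2 ⟨0, fun v hv => by rwa [zero_add]⟩
  obtain ⟨v, hv⟩ := nonempty_of_mem (inter_mem h1 h2)
  exact D.eq_of_mem_chamber hv.1 hv.2

theorem map_sectorGerm {g : V ≃ᵃ[ℝ] V} {u : D.weyl}
    (hg : ∀ x v, g (x + v) = g x + (u : V ≃ₗ[ℝ] V) v) (ε : ℤˣ) (w : D.weyl) :
    map g (sectorGerm (D.chamber ε w)) =
      sectorGerm (D.chamber ε ((u * w : D.weyl) : V ≃ₗ[ℝ] V)) := by
  have hu : ∀ v, (u : V ≃ₗ[ℝ] V) v ∈ D.chamber ε ((u * w : D.weyl) : V ≃ₗ[ℝ] V) ↔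
      v ∈ D.chamber ε w := fun v => by
    simp only [VectorialWeylData.mem_chamber_iff, VectorialWeylData.signedRoot_apply,
      ← LinearEquiv.mul_apply]
    simp
  ext S
  rw [mem_map, mem_sectorGerm, mem_sectorGerm]
  constructor
  · rintro ⟨x, hx⟩
    refine ⟨g x, fun v hv => ?_⟩
    have hv' : (u : V ≃ₗ[ℝ] V) ((u : V ≃ₗ[ℝ] V)⁻¹ v) = v := by
      rw [← LinearEquiv.mul_apply, mul_inv_cancel]; rfl
    rw [← hv', hu] at hv
    rw [← hv', ← hg]
    exact hx _ hv
  · rintro ⟨x, hx⟩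
    refine ⟨g.symm x, fun v hv => ?_⟩
    rw [Set.mem_preimage, hg, g.apply_symm_apply]
    exact hx _ ((hu v).2 hv)

/-- An intersection of half-spaces bounded by walls in the directions of a chamber. -/
theorem exists_closedHalves (ε : ℤˣ) (w : D.weyl) {k : ι → ℝ}
    (hk : ∀ j, k j ∈ 𝔸.levels (D.signedRoot ε w j)) :
    ∃ c : Module.Dual ℝ V → Set V, (∀ a ∈ 𝔸.allRoots, c a ∈ 𝔸.closedHalves a) ∧
      (⋂ a ∈ 𝔸.allRoots, c a) = {v | ∀ j, 0 ≤ D.signedRoot ε w j v + k j} := by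
  -- Roots other than the ε w α_j receive the whole space; injectivity of `signedRoot` ensures that
  -- each remaining root receives a single half-space.
  refine ⟨fun a => {v | ∀ j, D.signedRoot ε w j = a → 0 ≤ a v + k j}, fun a _ => ?_, ?_⟩
  · by_cases h : ∃ j, D.signedRoot ε w j = a
    · obtain ⟨j, rfl⟩ := h
      refine Or.inr ⟨k j, hk j, ?_⟩
      ext v
      refine ⟨fun h => h j rfl, fun h l hl => ?_⟩
      rwa [D.signedRoot_injective ε w hl]
    · left
      ext v
      simp only [Set.mem_ofPred_eq, Set.mem_univ, iff_true]
      exact fun j hj => absurd ⟨j, hj⟩ h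
  · ext v
    simp only [Set.mem_iInter, Set.mem_ofPred_eq]
    constructor
    · exact fun h j => h _ (Or.inl (D.signedRoot_mem_roots ε w j)) j rfl
    · rintro h a - j rfl
      exact h j

/-- Shortening moves the chimney across the walls whose roots are positive on its direction, but not
across those indexed by `J`, whose roots vanish there. Hence only the latter constrain the base
point. -/
theorem mem_chimneyGerm_of_levels {ε : ℤˣ} {w : D.weyl} {J : Set ι} {k : ι → ℝ}
    (hk : ∀ j, k j ∈ 𝔸.levels (D.signedRoot ε w j)) {x : V} (F₀ : Set V)
    (hx : ∀ j ∈ J, 0 < D.signedRoot ε w j x + k j) :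
    {v | ∀ j, 0 ≤ D.signedRoot ε w j v + k j} ∈ 𝔸.chimneyGerm x F₀ (D.facet ε w J) := by
  classical
  have hex : ∀ j, ∃ l ∈ 𝔸.levels (D.signedRoot ε w j), 0 < D.signedRoot ε w j x + l ∧
      (j ∈ J → l = k j) := fun j => by
    by_cases hj : j ∈ J
    · exact ⟨k j, hk j, hx j hj, fun _ => rfl⟩
    · obtain ⟨l, hl, hlt⟩ :=
        𝔸.exists_level_gt (D.signedRoot_mem_roots ε w j) (-D.signedRoot ε w j x)
      exact ⟨l, hl, by linarith, fun h => absurd h hj⟩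
  choose l hl hlx hlJ using hex
  -- The term `l j - k j` makes up for the change of level, and the bound 1 keeps ξ inside the open
  -- facet.
  obtain ⟨ξ, hξ⟩ := D.exists_signedRoot_apply_eq ε w
    fun j => if j ∈ J then 0 else max 1 (l j - k j)
  have hξF : ξ ∈ D.facet ε w J := D.mem_facet_iff.2
    ⟨fun j hj => by rw [hξ, if_pos hj],
      fun j hj => by rw [hξ, if_neg hj]; exact lt_max_of_lt_left one_pos⟩
  obtain ⟨c, hc, hceq⟩ := 𝔸.exists_closedHalves ε w hk
  obtain ⟨c', hc', hceq'⟩ := 𝔸.exists_closedHalves ε w hl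
  refine 𝔸.mem_chimneyGerm.2 ⟨ξ, subset_closure hξF, 𝔸.mem_shortChimney.2
    ⟨c, hc, ⟨_, 𝔸.mem_affFacet_of_mem_nhds (fun a ha => Or.inl (hc' a ha)) ?_, ?_⟩, hceq.le⟩⟩
  · rw [hceq']
    have : ∀ᶠ v in 𝓝 x, ∀ j, 0 < D.signedRoot ε w j v + l j := by
      rw [eventually_all]
      intro j
      have hcont : Continuous fun v => D.signedRoot ε w j v + l j :=
        (LinearMap.continuous_of_finiteDimensional _).add continuous_const
      exact hcont.continuousAt.eventually (lt_mem_nhds (hlx j))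
    exact this.mono fun v hv j => (hv j).le
  · rw [hceq, hceq']
    intro u hu v hv j
    have hu := hu j
    have hv := D.signedRoot_of_mem_closure_facet (subset_closure hv)
    have hv2 := hv.2 j
    rw [map_add, map_add, hξ]
    split_ifs with hj
    · rw [hlJ j hj] at hu
      linarith
    · linarith [le_max_right 1 (l j - k j)]

theorem nonempty_of_mem_affFacet {x : V} {ε : ℤˣ} {w : D.weyl} {J : Set ι} {S : Set V}
    (hS : S ∈ 𝔸.affFacet x (D.facet ε w J)) : S.Nonempty := by
  obtain ⟨c, -, hc, hcS⟩ := hS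
  have : (localFacet x (D.facet ε w J)).NeBot :=
    mem_closure_iff_nhdsWithin_neBot.1 (D.mem_closure_add_facet x ε w J)
  exact (Filter.nonempty_of_mem hc).mono hcS

/-- A set in the germ of a chimney contains a translate of its direction. -/
theorem exists_add_mem_of_mem_chimneyGerm {x : V} {ε ε' : ℤˣ} {w w' : D.weyl} {J J' : Set ι}
    {S : Set V} (hS : S ∈ 𝔸.chimneyGerm x (D.facet ε w J) (D.facet ε' w' J')) :
    ∃ y, ∀ v ∈ D.facet ε' w' J', y + v ∈ S := by
  obtain ⟨ξ, -, hξ⟩ := 𝔸.mem_chimneyGerm.1 hS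
  obtain ⟨c, -, ⟨U, hU, h⟩, hcS⟩ := 𝔸.mem_shortChimney.1 hξ
  obtain ⟨u, hu⟩ := 𝔸.nonempty_of_mem_affFacet hU
  exact ⟨u + ξ, fun v hv => hcS (h u hu v hv)⟩

/-- When the direction is a chamber, no wall constrains the base point, so the base is irrelevant;
this brings sector germs within the scope of (MA3) and (MA4). -/
theorem chimneyGerm_chamber (x : V) (ε ε' : ℤˣ) (w w' : D.weyl) (J : Set ι) :
    𝔸.chimneyGerm x (D.facet ε w J) (D.chamber ε' w') = sectorGerm (D.chamber ε' w') := by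
  refine le_antisymm (fun S hS => ?_) fun S hS =>
    mem_sectorGerm.2 (𝔸.exists_add_mem_of_mem_chimneyGerm hS)
  obtain ⟨q, hq⟩ := mem_sectorGerm.1 hS
  obtain ⟨k, hk, hsub⟩ := 𝔸.exists_levels_subset_add_chamber ε' w' q
  refine mem_of_superset (𝔸.mem_chimneyGerm_of_levels (J := ∅) hk _ (by simp)) fun v hv => ?_
  have := hq _ (hsub v hv)
  rwa [add_sub_cancel] at this

theorem isOpen_add_chamber (x : V) (ε : ℤˣ) (w : D.weyl) :
    IsOpen ((fun v => x + v) '' D.chamber ε w) :=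
  (Homeomorph.addLeft x).isOpenMap _ (D.isOpen_chamber ε w)

/-- Every set in a chimney based on an alcove contains a nonempty open set, so its support is the
whole space, and only the identity fixes that pointwise. -/
theorem chimneySolid_of_chamber (x : V) (ε ε' : ℤˣ) (w w' : D.weyl) (J : Set ι) :
    𝔸.ChimneySolid x (D.chamber ε w) (D.facet ε' w' J) := by
  have htop : support (𝔸.chimney x (D.chamber ε w) (D.facet ε' w' J)) = ⊤ := by
    refine eq_top_iff.2 (le_sInf ?_)
    rintro E ⟨c, -, hc, hcE⟩
    obtain ⟨U, ⟨c', -, hc', hcU⟩, T, hT, h⟩ := mem_map₂_iff.1 hc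
    obtain ⟨O, hO, hxO, hOU⟩ := mem_nhdsWithin.1 hc'
    obtain ⟨v, hv⟩ := D.exists_mem_facet ε' w' J
    have hopen : IsOpen ((fun u => u + v) '' (O ∩ (fun v => x + v) '' D.chamber ε w)) :=
      (Homeomorph.addRight v).isOpenMap _ (hO.inter (isOpen_add_chamber x ε w))
    have hne : ((fun u => u + v) '' (O ∩ (fun v => x + v) '' D.chamber ε w)).Nonempty :=
      (mem_closure_iff.1 (D.mem_closure_add_facet x ε w ∅) O hO hxO).image _
    rw [← hopen.affineSpan_eq_top hne, affineSpan_le]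
    rintro _ ⟨u, hu, rfl⟩
    exact hcE (h ⟨u, hcU (hOU hu), v, hT hv, rfl⟩)
  refine (Set.finite_singleton (1 : V ≃ₗ[ℝ] V)).subset ?_
  rintro g ⟨-, hg⟩
  rw [htop, AffineSubspace.direction_top] at hg
  exact LinearEquiv.ext fun v => hg v Submodule.mem_top

theorem isSplayed_sectorGerm (ε : ℤˣ) (w : D.weyl) :
    𝔸.IsSplayedChimneyGerm (sectorGerm (D.chamber ε w)) :=
  ⟨0, D.chamber ε w, D.chamber ε w, isVecFacet_facet ε w ∅,
    ⟨ε, w, w.2, ∅, D.finite_closure_refl_empty, rfl⟩, (𝔸.chimneyGerm_chamber 0 ε ε w w ∅).symm⟩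

theorem isSolid_sectorGerm (ε : ℤˣ) (w : D.weyl) :
    𝔸.IsSolidChimneyGerm (sectorGerm (D.chamber ε w)) :=
  ⟨0, D.chamber ε w, D.chamber ε w, isVecFacet_facet ε w ∅, isVecFacet_facet ε w ∅,
    𝔸.chimneySolid_of_chamber 0 ε ε w w ∅, (𝔸.chimneyGerm_chamber 0 ε ε w w ∅).symm⟩

theorem isSolid_panel (x : V) (ε ε' : ℤˣ) (w w' : D.weyl) (i : ι) :
    𝔸.IsSolidChimneyGerm (𝔸.chimneyGerm x (D.chamber ε w) (D.facet ε' w' {i})) :=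
  ⟨x, _, _, isVecFacet_facet ε w ∅, isVecFacet_facet ε' w' {i},
    𝔸.chimneySolid_of_chamber x ε ε' w w' {i}, rfl⟩

theorem isClosed_iInter_closedHalves {c : Module.Dual ℝ V → Set V}
    (hc : ∀ a ∈ 𝔸.allRoots, c a ∈ 𝔸.closedHalves a) : IsClosed (⋂ a ∈ 𝔸.allRoots, c a) := by
  refine isClosed_biInter fun a ha => ?_
  rcases hc a ha with h | ⟨k, -, h⟩
  · rw [h]; exact isClosed_univ
  · rw [h]
    exact isClosed_le continuous_const
      ((LinearMap.continuous_of_finiteDimensional a).add continuous_const)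

/-- A set in the germ of a chimney based on an alcove at `p` belongs to the germs of the chimneys
based on the minimal facets at the points near `p` in the direction of the alcove. -/
theorem mem_chimneyGerm_add_smul {p u : V} {ε ε' : ℤˣ} {w w' : D.weyl} {J : Set ι} {S Z : Set V}
    (hS : S ∈ 𝔸.chimneyGerm p (D.chamber ε w) (D.facet ε' w' J)) (hu : u ∈ D.chamber ε w)
    (hZ : ∀ z ∈ Z, ∀ j, D.signedRoot ε w j z = 0) :
    ∃ δ > 0, ∀ τ : ℝ, 0 ≤ τ → τ < δ → S ∈ 𝔸.chimneyGerm (p + τ • u) Z (D.facet ε' w' J) := by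
  obtain ⟨ξ, hξ, hξS⟩ := 𝔸.mem_chimneyGerm.1 hS
  obtain ⟨c, hc, ⟨U₀, ⟨h, hh, hhp, hU₀⟩, hU⟩, hcS⟩ := 𝔸.mem_shortChimney.1 hξS
  set U := ⋂ a ∈ 𝔸.allRoots, h a with hUdef
  obtain ⟨O, hO, hpO, hOU⟩ := mem_nhdsWithin.1 hhp
  have hOopen : IsOpen (O ∩ (fun v => p + v) '' D.chamber ε w) :=
    hO.inter (isOpen_add_chamber p ε w)
  have hev : ∀ᶠ τ : ℝ in 𝓝[>] 0, p + τ • u ∈ O ∩ (fun v => p + v) '' D.chamber ε w := by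
    filter_upwards [tendsto_add_smul_nhdsGT p u (hO.mem_nhds hpO), self_mem_nhdsWithin] with τ h1 h2
    exact ⟨h1, τ • u, D.smul_mem_facet hu h2, rfl⟩
  obtain ⟨o, hoU⟩ : U.Nonempty := by
    obtain ⟨τ, hτ⟩ := hev.exists
    exact ⟨_, hOU hτ⟩
  obtain ⟨δ, hδ, hsub⟩ := mem_nhdsGT_iff_exists_Ioo_subset.1 hev
  refine ⟨δ, hδ, fun τ hτ0 hτ => ?_⟩
  -- For τ > 0 the point is interior to the open part of the alcove, and `U` itself serves. At τ = 0
  -- it lies on the boundary, so the open half-spaces must be replaced by closed ones, and the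
  -- conclusion recovered by passing to the limit in the closed set cut out by `c`.
  rcases hτ0.eq_or_lt with rfl | hpos
  · have hex : ∀ a, ∃ b : Set V, a ∈ 𝔸.allRoots → b ∈ 𝔸.closedHalves a ∧ h a ⊆ b ∧
        ∀ v ∈ b, ∀ y ∈ h a, ∀ s : ℝ, 0 < s → s < 1 → v + s • (y - v) ∈ h a := fun a => by
      by_cases ha : a ∈ 𝔸.allRoots
      swap
      · exact ⟨∅, fun h => absurd h ha⟩
      rcases hh a ha with (hha | ⟨k, hk, hha⟩) | ⟨k, hk, hha⟩
      · exact ⟨Set.univ, fun _ => ⟨Or.inl rfl, Set.subset_univ _, by simp [hha]⟩⟩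
      all_goals
        refine ⟨{v | 0 ≤ a v + k}, fun _ => ⟨Or.inr ⟨k, hk, rfl⟩, ?_, ?_⟩⟩
        · intro v hv
          rw [hha] at hv
          simp only [Set.mem_ofPred_eq] at hv ⊢
          linarith
        · rw [hha]
          intro v hv y hy s hs hs1
          simp only [Set.mem_ofPred_eq, map_add, map_smul, map_sub, smul_eq_mul] at hv hy ⊢
          have h1 : a v + s * (a y - a v) + k = (1 - s) * (a v + k) + s * (a y + k) := by ring
          rw [h1]
          have := mul_nonneg (sub_nonneg.2 hs1.le) hv
          first
          | linarith [mul_pos hs hy]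
          | linarith [mul_nonneg hs.le hy]
    choose b hb using hex
    have hbc : IsClosed (⋂ a ∈ 𝔸.allRoots, b a) :=
      𝔸.isClosed_iInter_closedHalves fun a ha => (hb a ha).1
    have hUb : U ⊆ ⋂ a ∈ 𝔸.allRoots, b a :=
      Set.iInter₂_mono fun a ha => (hb a ha).2.1
    rw [zero_smul, add_zero]
    refine 𝔸.mem_chimneyGerm.2 ⟨ξ, hξ, 𝔸.mem_shortChimney.2
      ⟨c, hc, ⟨⋂ a ∈ 𝔸.allRoots, b a, ⟨b, fun a ha => Or.inl (hb a ha).1, ?_, subset_rfl⟩, ?_⟩,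
        hcS⟩⟩
    · refine mem_nhdsWithin.2 ⟨O, hO, hpO, ?_⟩
      rintro _ ⟨hzO, z, hz, rfl⟩
      -- All the roots ε w α_j vanish at z, so z + su stays in the chamber for s > 0, and p + z is a
      -- limit of points of `U`.
      refine hbc.mem_of_tendsto (tendsto_add_smul_nhdsGT (p + z) u) ?_
      filter_upwards [tendsto_add_smul_nhdsGT (p + z) u (hO.mem_nhds hzO), self_mem_nhdsWithin]
        with s h1 h2
      refine hUb (hOU ⟨h1, z + s • u, D.mem_chamber_iff.2 fun j => ?_, (add_assoc _ _ _).symm⟩)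
      rw [map_add, hZ z hz, zero_add]
      exact D.mem_chamber_iff.1 (D.smul_mem_facet hu h2) j
    · intro v hv y hy
      have hcl := 𝔸.isClosed_iInter_closedHalves hc
      -- Moving from v slightly towards a point o of `U` enters all the open half-spaces at once.
      have ht : Tendsto (fun s : ℝ => v + s • (o - v) + ξ + y) (𝓝[>] 0) (𝓝 (v + ξ + y)) :=
        ((tendsto_add_smul_nhdsGT v (o - v)).add_const ξ).add_const y
      refine hcl.mem_of_tendsto ht ?_
      filter_upwards [Ioo_mem_nhdsGT (zero_lt_one' ℝ)] with s hs
      refine hU _ (hU₀ ?_) y hy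
      simp only [Set.mem_iInter, hUdef] at hv hoU ⊢
      exact fun a ha => (hb a ha).2.2 v (hv a ha) o (hoU a ha) s hs.1 hs.2
  · have hmem := hsub ⟨hpos, hτ⟩
    exact 𝔸.mem_chimneyGerm.2 ⟨ξ, hξ, 𝔸.mem_shortChimney.2 ⟨c, hc, ⟨U,
      𝔸.mem_affFacet_of_mem_nhds hh (mem_of_superset (hOopen.mem_nhds hmem) hOU),
      fun v hv => hU v (hU₀ hv)⟩, hcS⟩⟩

/-- The enclosure of a panel chimney germ and of a sector germ contains the sector germ which
dominates the panel on the side of the given sector germ. -/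
theorem sectorGerm_le_cl {p : V} {ε ε₁ ε₂ : ℤˣ} {w₀ w w₁ : D.weyl} {J : Set ι} {i : ι}
    (hpos : ∀ v ∈ D.chamber ε₁ w₁, 0 < D.signedRoot ε₂ w i v) :
    sectorGerm (D.chamber ε₂ w) ≤
      𝔸.cl (𝔸.chimneyGerm p (D.facet ε w₀ J) (D.facet ε₂ w {i}) ⊔
        sectorGerm (D.chamber ε₁ w₁)) := by
  rintro S ⟨c, hc, ⟨hcR, hcF⟩, hcS⟩
  obtain ⟨y, hy⟩ := 𝔸.exists_add_mem_of_mem_chimneyGerm hcR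
  obtain ⟨q, hq⟩ := mem_sectorGerm.1 hcF
  obtain ⟨v₁, hv₁⟩ := D.exists_mem_chamber ε₁ w₁
  obtain ⟨v₂, hv₂⟩ := D.exists_mem_facet ε₂ w {i}
  -- The translation is chosen before the root `a`: it must serve all the half-spaces of the
  -- enclosure, possibly infinitely many.
  refine mem_sectorGerm.2 ⟨q + v₁, fun v hv => hcS ?_⟩
  simp only [Set.mem_iInter] at hy hq ⊢
  intro a ha
  rcases hc a ha with h | ⟨k, -, h⟩
  · rw [h]; trivial
  have hy' := fun v hv => hy v hv a ha
  have hq' := fun v hv => hq v hv a ha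
  rw [h] at hy' hq' ⊢
  simp only [Set.mem_ofPred_eq] at hy' hq' ⊢
  -- A half-space containing a ray has a root nonnegative on its direction; otherwise the chosen t
  -- makes t a(u) equal to -(|a(z) + k| + 1).
  have cone : ∀ (z u : V), (∀ t : ℝ, 0 < t → 0 ≤ a (z + t • u) + k) → 0 ≤ a u := by
    intro z u h
    by_contra! hneg
    have h1 := h ((|a z + k| + 1) / -a u) (div_pos (by positivity) (neg_pos.2 hneg))
    rw [map_add, map_smul, smul_eq_mul, div_mul_eq_mul_div, mul_div_assoc, div_neg,
      div_self hneg.ne] at h1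
    linarith [le_abs_self (a z + k)]
  have ha1 : 0 ≤ a v₁ := cone q v₁ fun t ht => hq' _ (D.smul_mem_facet hv₁ ht)
  have ha2 : 0 ≤ a v₂ := cone y v₂ fun t ht => hy' _ (D.smul_mem_facet hv₂ ht)
  obtain ⟨d, hd, hav⟩ := 𝔸.exists_coeff_of_mem_allRoots ha ε₂ w
  rw [VectorialWeylData.mem_facet_iff] at hv₂
  rw [VectorialWeylData.mem_chamber_iff] at hv
  -- If all coefficients are nonpositive, nonnegativity on the panel kills those with j ≠ i, and
  -- nonnegativity at v₁, where ε₂ w α_i is positive, handles the last. The constant sign of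
  -- coefficients for imaginary roots is where the moderately imaginary hypothesis enters.
  have hd0 : ∀ j, 0 ≤ d j := by
    rcases hd with hd | hd
    · exact hd
    have hterm : ∀ j ∈ Finset.univ, d j * D.signedRoot ε₂ w j v₂ ≤ 0 := fun j _ => by
      by_cases hj : j = i
      · rw [hj, hv₂.1 i rfl, mul_zero]
      · exact mul_nonpos_of_nonpos_of_nonneg (hd j) (hv₂.2 j hj).le
    have hzero : ∀ j, j ≠ i → d j = 0 := by
      have h0 : ∑ j, d j * D.signedRoot ε₂ w j v₂ = 0 :=
        le_antisymm (Finset.sum_nonpos hterm) (hav v₂ ▸ ha2)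
      intro j hj
      have := (Finset.sum_eq_zero_iff_of_nonpos hterm).1 h0 j (Finset.mem_univ _)
      exact (mul_eq_zero.1 this).resolve_right (hv₂.2 j hj).ne'
    intro j
    by_cases hj : j = i
    · rw [hav, Finset.sum_eq_single i (fun j _ hj => by rw [hzero j hj, zero_mul])
        (fun h => absurd (Finset.mem_univ _) h)] at ha1
      rw [hj]
      exact nonneg_of_mul_nonneg_left ha1 (hpos v₁ hv₁)
    · exact (hzero j hj).ge
  have hav0 : 0 ≤ a v := by
    rw [hav]
    exact Finset.sum_nonneg fun j _ => mul_nonneg (hd0 j) (hv j).le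
  rw [map_add]
  linarith [hq' v₁ hv₁]

end AffineApartment
end

noncomputable section

/-! ### Sector germs read in the charts of the hovel. -/

namespace AffineHovel

open AffineApartment

variable {V ι I : Type*} [NormedAddCommGroup V] [NormedSpace ℝ V]
  [Fintype ι] {D : VectorialWeylData V ι} {𝔸 : AffineApartment D} (H : AffineHovel 𝔸 I)

theorem apt_mem_map {A : Set I} (hA : A ∈ H.apts) {f : V → I} (hf : f ∈ H.isom A) (F : Filter V) :
    A ∈ map f F := by
  rw [← (H.isom_bijOn A hA f hf).2]
  exact range_mem_map

theorem exists_chart_eq {A A' : Set I} (hA : A ∈ H.apts) (hA' : A' ∈ H.apts) {f : V → I}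
    (hf : f ∈ H.isom A) {R F : Filter V} (hR : 𝔸.IsSplayedChimneyGerm R)
    (hF : 𝔸.IsSolidChimneyGerm F) (hAR : A' ∈ map f R) (hAF : A' ∈ map f F) :
    ∃ f' ∈ H.isom A', ∀ᶠ v in 𝔸.cl (R ⊔ F), f' v = f v := by
  obtain ⟨-, φ, hφ, h⟩ := H.ma4 A hA f hf R F hR (Or.inr hF) A' hA' hAR hAF
  exact ⟨_, hφ, h⟩

theorem eventually_of_cl_left {R F : Filter V} {p : V → Prop} (h : ∀ᶠ v in 𝔸.cl (R ⊔ F), p v) :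
    ∀ᶠ v in R, p v := h.filter_mono (le_sup_left.trans (𝔸.le_cl _))

theorem eventually_of_cl_right {R F : Filter V} {p : V → Prop} (h : ∀ᶠ v in 𝔸.cl (R ⊔ F), p v) :
    ∀ᶠ v in F, p v := h.filter_mono (le_sup_right.trans (𝔸.le_cl _))

theorem chartGerm_congr {f f' : V → I} {ε : ℤˣ} {w : D.weyl}
    (h : ∀ᶠ v in sectorGerm (D.chamber ε w), f v = f' v) :
    chartGerm D f ε w = chartGerm D f' ε w := map_congr h

theorem nonempty_sectorGerm [Nonempty I] (ε : ℤˣ) : Nonempty (H.SectorGerm ε) := by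
  obtain ⟨x⟩ := ‹Nonempty I›
  obtain ⟨A, hA, -⟩ : x ∈ ⋃₀ H.apts := H.covering ▸ Set.mem_univ x
  obtain ⟨f, hf⟩ := H.isom_nonempty A hA
  exact ⟨⟨_, A, hA, f, hf, 1, rfl⟩⟩

variable [FiniteDimensional ℝ V]

/-- Two charts of an apartment read the direction of sector germs up to a common factor. -/
theorem exists_weyl_chartGerm {A : Set I} (hA : A ∈ H.apts) {f f' : V → I} (hf : f ∈ H.isom A)
    (hf' : f' ∈ H.isom A) : ∃ (g : V ≃ᵃ[ℝ] V) (u : D.weyl), f' = f ∘ g ∧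
      (∀ x v, g (x + v) = g x + (u : V ≃ₗ[ℝ] V) v) ∧
      ∀ ε w, chartGerm D f' ε w = chartGerm D f ε (u * w) := by
  obtain ⟨g, hg, hfg⟩ := (H.isom_iff A hA f hf f').1 hf'
  obtain ⟨u, hu⟩ := 𝔸.exists_weyl_eq_linear hg
  refine ⟨g, u, hfg, hu, fun ε w => ?_⟩
  rw [chartGerm, chartGerm, ← map_sectorGerm hu, hfg, map_map]

theorem chartGerm_injective {A : Set I} (hA : A ∈ H.apts) {f : V → I} (hf : f ∈ H.isom A)
    {ε : ℤˣ} {w w' : D.weyl} (h : chartGerm D f ε w = chartGerm D f ε w') : w = w' :=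
  sectorGerm_injective ((map_inj (H.isom_bijOn A hA f hf).1).1 h)

/-- An apartment containing a sector germ has a chart which coincides with a given one on it. -/
theorem exists_chart_eq_on_sectorGerm {A A' : Set I} (hA : A ∈ H.apts) (hA' : A' ∈ H.apts)
    {f : V → I} (hf : f ∈ H.isom A) {ε : ℤˣ} {w : D.weyl} (h : A' ∈ chartGerm D f ε w) :
    ∃ f' ∈ H.isom A', ∀ᶠ v in sectorGerm (D.chamber ε w), f' v = f v := by
  obtain ⟨f', hf', h'⟩ := H.exists_chart_eq hA hA' hf (𝔸.isSplayed_sectorGerm ε w)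
    (𝔸.isSolid_sectorGerm ε w) h h
  exact ⟨f', hf', eventually_of_cl_left h'⟩

/-- A sector germ contained in an apartment is read in each of its charts. -/
theorem exists_eq_chartGerm {ε : ℤˣ} (Q : H.SectorGerm ε) {A : Set I} (hA : A ∈ H.apts)
    (hQ : A ∈ Q.1) {f : V → I} (hf : f ∈ H.isom A) : ∃ w, Q.1 = chartGerm D f ε w := by
  obtain ⟨Q, A₀, hA₀, f₀, hf₀, w₀, rfl⟩ := Q
  obtain ⟨f', hf', h⟩ := H.exists_chart_eq_on_sectorGerm hA₀ hA hf₀ hQ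
  obtain ⟨g, u, -, -, hu⟩ := H.exists_weyl_chartGerm hA hf hf'
  exact ⟨u * w₀, by rw [← hu, chartGerm_congr h]⟩

theorem exists_common_apt {ε₁ ε₂ : ℤˣ} (Q₁ : H.SectorGerm ε₁) (Q₂ : H.SectorGerm ε₂) :
    ∃ A ∈ H.apts, A ∈ Q₁.1 ∧ A ∈ Q₂.1 := by
  obtain ⟨Q₁, A₁, hA₁, f₁, hf₁, w₁, rfl⟩ := Q₁
  obtain ⟨Q₂, A₂, hA₂, f₂, hf₂, w₂, rfl⟩ := Q₂
  exact H.ma3 A₁ hA₁ f₁ hf₁ A₂ hA₂ f₂ hf₂ _ _ (𝔸.isSplayed_sectorGerm ε₁ w₁)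
    (Or.inr (𝔸.isSolid_sectorGerm ε₂ w₂))

theorem exists_readIn {ε₁ ε₂ : ℤˣ} (Q₁ : H.SectorGerm ε₁) (Q₂ : H.SectorGerm ε₂) {A : Set I}
    (hA : A ∈ H.apts) (h₁ : A ∈ Q₁.1) (h₂ : A ∈ Q₂.1) {f : V → I} (hf : f ∈ H.isom A) :
    ∃ w₁ w₂, H.ReadIn Q₁ Q₂ A f w₁ w₂ := by
  obtain ⟨w₁, hw₁⟩ := H.exists_eq_chartGerm Q₁ hA h₁ hf
  obtain ⟨w₂, hw₂⟩ := H.exists_eq_chartGerm Q₂ hA h₂ hf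
  exact ⟨w₁, w₂, hA, hf, hw₁, hw₂⟩

variable {H}

/-- (MA4) supplies a chart of the second apartment agreeing with the first chart on both germs;
passing to any other chart there multiplies both directions on the left by one element, which
cancels. -/
theorem ReadIn.unique {ε₁ ε₂ : ℤˣ} {Q₁ : H.SectorGerm ε₁} {Q₂ : H.SectorGerm ε₂} {A A' : Set I}
    {f f' : V → I} {w₁ w₂ w₁' w₂' : D.weyl} (h : H.ReadIn Q₁ Q₂ A f w₁ w₂)
    (h' : H.ReadIn Q₁ Q₂ A' f' w₁' w₂') : w₁⁻¹ * w₂ = w₁'⁻¹ * w₂' := by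
  obtain ⟨hA, hf, h₁, h₂⟩ := h
  obtain ⟨hA', hf', h₁', h₂'⟩ := h'
  obtain ⟨f'', hf'', heq⟩ := H.exists_chart_eq hA hA' hf (𝔸.isSplayed_sectorGerm ε₁ w₁)
    (𝔸.isSolid_sectorGerm ε₂ w₂)
    (show A' ∈ chartGerm D f ε₁ w₁ by rw [← h₁, h₁']; exact H.apt_mem_map hA' hf' _)
    (show A' ∈ chartGerm D f ε₂ w₂ by rw [← h₂, h₂']; exact H.apt_mem_map hA' hf' _)
  obtain ⟨g, u, -, -, hu⟩ := H.exists_weyl_chartGerm hA' hf' hf''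
  have e₁ : w₁' = u * w₁ := H.chartGerm_injective hA' hf' <| by
    rw [← h₁', h₁, ← hu, chartGerm_congr (eventually_of_cl_left heq)]
  have e₂ : w₂' = u * w₂ := H.chartGerm_injective hA' hf' <| by
    rw [← h₂', h₂, ← hu, chartGerm_congr (eventually_of_cl_right heq)]
  rw [e₁, e₂]
  group

theorem ReadIn.relPos_eq {ε₁ ε₂ : ℤˣ} {Q₁ : H.SectorGerm ε₁} {Q₂ : H.SectorGerm ε₂} {A : Set I}
    {f : V → I} {w₁ w₂ : D.weyl} (h : H.ReadIn Q₁ Q₂ A f w₁ w₂) :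
    H.relPos Q₁ Q₂ = w₁⁻¹ * w₂ := by
  have hex : ∃ u : D.weyl, ∃ A f w₁ w₂, H.ReadIn Q₁ Q₂ A f w₁ w₂ ∧ u = w₁⁻¹ * w₂ :=
    ⟨_, A, f, w₁, w₂, h, rfl⟩
  rw [relPos, dif_pos hex]
  obtain ⟨A', f', w₁', w₂', h', e⟩ := hex.choose_spec
  rw [e]
  exact h'.unique h

variable (H)

theorem exists_readIn_relPos {ε₁ ε₂ : ℤˣ} (Q₁ : H.SectorGerm ε₁) (Q₂ : H.SectorGerm ε₂) :
    ∃ A f w₁ w₂, H.ReadIn Q₁ Q₂ A f w₁ w₂ := by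
  obtain ⟨A, hA, h₁, h₂⟩ := H.exists_common_apt Q₁ Q₂
  obtain ⟨f, hf⟩ := H.isom_nonempty A hA
  obtain ⟨w₁, w₂, h⟩ := H.exists_readIn Q₁ Q₂ hA h₁ h₂ hf
  exact ⟨A, f, w₁, w₂, h⟩

theorem relPos_inv {ε₁ ε₂ : ℤˣ} (Q₁ : H.SectorGerm ε₁) (Q₂ : H.SectorGerm ε₂) :
    H.relPos Q₂ Q₁ = (H.relPos Q₁ Q₂)⁻¹ := by
  obtain ⟨A, f, w₁, w₂, h⟩ := H.exists_readIn_relPos Q₁ Q₂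
  have h' : H.ReadIn Q₂ Q₁ A f w₂ w₁ := ⟨h.1, h.2.1, h.2.2.2, h.2.2.1⟩
  rw [h.relPos_eq, h'.relPos_eq, mul_inv_rev, inv_inv]

theorem relPos_eq_one_iff {ε : ℤˣ} (Q₁ Q₂ : H.SectorGerm ε) : H.relPos Q₁ Q₂ = 1 ↔ Q₁ = Q₂ := by
  obtain ⟨A, f, w₁, w₂, h⟩ := H.exists_readIn_relPos Q₁ Q₂
  rw [h.relPos_eq, inv_mul_eq_one]
  obtain ⟨hA, hf, h₁, h₂⟩ := h
  constructor
  · rintro rfl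
    exact Subtype.ext (h₁.trans h₂.symm)
  · rintro rfl
    exact H.chartGerm_injective hA hf (h₁.symm.trans h₂)

theorem exists_adjacent {ε₁ ε₂ : ℤˣ} (Q : H.SectorGerm ε₁) (Q₁ : H.SectorGerm ε₂) (s : D.weyl) :
    ∃ Q₂ : H.SectorGerm ε₂, H.relPos Q₁ Q₂ = s ∧ H.relPos Q Q₂ = H.relPos Q Q₁ * s := by
  obtain ⟨A, f, w, w₁, h⟩ := H.exists_readIn_relPos Q Q₁
  have hr := h.relPos_eq
  obtain ⟨hA, hf, hQ, hQ₁⟩ := h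
  obtain ⟨Q₂, hQ₂⟩ : ∃ Q₂ : H.SectorGerm ε₂, Q₂.1 = chartGerm D f ε₂ (w₁ * s) :=
    ⟨⟨_, A, hA, f, hf, _, rfl⟩, rfl⟩
  refine ⟨Q₂, ?_, ?_⟩
  · rw [ReadIn.relPos_eq ⟨hA, hf, hQ₁, hQ₂⟩]
    group
  · rw [ReadIn.relPos_eq ⟨hA, hf, hQ, hQ₂⟩, hr, mul_assoc]

/-! ### Projection of a sector germ onto a panel -/

/-- In the chart `f'`, consider the panel of type `i` of the chamber `ε₂ w₂ C` and the germ of the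
chimney of this direction based at the minimal facet at `p`. The sector germ `Y` is the projection
of the sector germ `Q`: in some apartment containing `Q` and this chimney germ, `Y` dominates the
panel and is on the same side of the panel as `Q`. -/
def IsProj (ε₁ ε₂ : ℤˣ) (w₂ : D.weyl) (i : ι) (f' : V → I) (Q : Filter I) (p : V)
    (Y : Filter I) : Prop :=
  ∃ A ∈ H.apts, ∃ f ∈ H.isom A, ∃ w₁ w : D.weyl,
    (∀ᶠ v in 𝔸.chimneyGerm p (D.facet ε₂ w₂ Set.univ) (D.facet ε₂ w₂ {i}), f v = f' v) ∧
    Q = chartGerm D f ε₁ w₁ ∧ (w = w₂ ∨ w = w₂ * D.simpleRefl i) ∧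
    (D.cs.length (w₁⁻¹ * w) < D.cs.length (w₁⁻¹ * w * D.simpleRefl i) ↔ ε₁ = ε₂) ∧
    Y = chartGerm D f ε₂ w

/-- (MA4), applied to the panel chimney germ and Q, identifies the two apartments on an enclosure
containing Y. The image of Y still dominates the panel on the side of Q, and only one sector germ of
the second apartment does. -/
theorem IsProj.unique {ε₁ ε₂ : ℤˣ} {w₂ : D.weyl} {i : ι} {f' : V → I} {Q : Filter I} {p : V}
    {Y Y' : Filter I} (h : H.IsProj ε₁ ε₂ w₂ i f' Q p Y) (h' : H.IsProj ε₁ ε₂ w₂ i f' Q p Y') :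
    Y = Y' := by
  obtain ⟨A, hA, f, hf, w₁, w, hff, hQ, hw, hside, rfl⟩ := h
  obtain ⟨A', hA', f₁, hf₁, w₁', w', hff', hQ', hw', hside', rfl⟩ := h'
  set R := 𝔸.chimneyGerm p (D.facet ε₂ w₂ Set.univ) (D.facet ε₂ w₂ {i})
  have hfacet : D.facet ε₂ w {i} = D.facet ε₂ w₂ {i} := by
    rcases hw with rfl | rfl
    · rfl
    · exact D.facet_mul_simpleRefl ε₂ w₂ i
  have hff₁ : ∀ᶠ v in R, f v = f₁ v := by
    filter_upwards [hff, hff'] with v h1 h2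
    rw [h1, h2]
  obtain ⟨f₂, hf₂, heq⟩ := H.exists_chart_eq hA hA' hf
    (𝔸.isSplayed_panel p ε₂ ε₂ w₂ w₂ Set.univ i) (𝔸.isSolid_sectorGerm ε₁ w₁)
    (by rw [map_congr hff₁]; exact H.apt_mem_map hA' hf₁ _)
    (show A' ∈ chartGerm D f ε₁ w₁ by rw [← hQ, hQ']; exact H.apt_mem_map hA' hf₁ _)
  obtain ⟨g, u, hfg, hg, hu⟩ := H.exists_weyl_chartGerm hA' hf₁ hf₂
  have eQ : w₁' = u * w₁ := H.chartGerm_injective hA' hf₁ <| by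
    rw [← hQ', hQ, ← hu, chartGerm_congr (eventually_of_cl_right heq)]
  have eY : chartGerm D f ε₂ w = chartGerm D f₁ ε₂ (u * w) := by
    rw [← hu]
    refine (chartGerm_congr (heq.filter_mono ?_)).symm
    rw [← hfacet]
    exact 𝔸.sectorGerm_le_cl fun v hv => D.signedRoot_pos_of_length hside hv
  have hfix : ∀ᶠ v in R, g v = v := by
    filter_upwards [eventually_of_cl_left heq, hff₁] with v h1 h2
    rw [h2, hfg] at h1
    exact (H.isom_bijOn A' hA' f₁ hf₁).1 h1
  obtain ⟨y, hy⟩ := 𝔸.exists_add_mem_of_mem_chimneyGerm hfix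
  -- The point y itself need not be fixed by g, so the linear part is obtained by comparing the
  -- fixed points y + v and y + 2v.
  have hu1 : ∀ v ∈ D.facet ε₂ w₂ {i}, (u : V ≃ₗ[ℝ] V) v = v := fun v hv => by
    have h1 : g (y + v) = y + v := hy v hv
    have h2 : g (y + (v + v)) = y + (v + v) := hy _ (D.add_mem_facet (subset_closure hv) hv)
    rw [← add_assoc, hg, h1] at h2
    exact add_left_cancel h2
  have huw : u * w = w₂ ∨ u * w = w₂ * D.simpleRefl i := by
    rcases D.eq_one_or_eq_of_fixes_panel hu1 with rfl | rfl
    · rwa [one_mul]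
    · rcases hw with rfl | rfl
      · right; group
      · left
        rw [mul_assoc _ w₂⁻¹, inv_mul_cancel_left, mul_assoc, D.simpleRefl_mul_self, mul_one]
  have hside₂ : D.cs.length (w₁'⁻¹ * (u * w)) <
      D.cs.length (w₁'⁻¹ * (u * w) * D.simpleRefl i) ↔ ε₁ = ε₂ := by
    have : w₁'⁻¹ * (u * w) = w₁⁻¹ * w := by rw [eQ]; group
    rwa [this]
  rw [eY, D.side_unique huw hw' hside₂ hside']

/-- One apartment serves all small τ: it is chosen to contain Q and the germ of the chimney based on
an alcove at p. Such a chimney is solid as well as splayed, so (MA4) gives a chart agreeing with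
`f'` on its germ. -/
theorem exists_isProj_add_smul {ε ε₁ ε₂ : ℤˣ} {w₂ : D.weyl} (i : ι) {A' : Set I} {f' : V → I}
    (hA' : A' ∈ H.apts) (hf' : f' ∈ H.isom A') (Q : H.SectorGerm ε₁) (p : V) {u : V}
    (hu : u ∈ D.chamber ε w₂) (hε : ε = ε₂ ∨ ε = -ε₂) : ∃ Y, ∃ δ > 0, ∀ τ : ℝ, 0 ≤ τ → τ < δ →
      H.IsProj ε₁ ε₂ w₂ i f' Q.1 (p + τ • u) Y := by
  obtain ⟨Q, A₀, hA₀, f₀, hf₀, w₀, rfl⟩ := Q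
  obtain ⟨A, hA, hAR, hAQ⟩ := H.ma3 A' hA' f' hf' A₀ hA₀ f₀ hf₀ _ _
    (𝔸.isSplayed_panel p ε ε₂ w₂ w₂ ∅ i) (Or.inr (𝔸.isSolid_sectorGerm ε₁ w₀))
  obtain ⟨f, hf, heq⟩ := H.exists_chart_eq hA' hA hf' (𝔸.isSplayed_panel p ε ε₂ w₂ w₂ ∅ i)
    (𝔸.isSolid_panel p ε ε₂ w₂ w₂ i) hAR hAR
  obtain ⟨w₁, hw₁⟩ := H.exists_eq_chartGerm (ε := ε₁) ⟨_, A₀, hA₀, f₀, hf₀, w₀, rfl⟩ hA hAQ hf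
  obtain ⟨w, hw, hside⟩ := D.exists_side ε₁ ε₂ w₁ w₂ i
  obtain ⟨δ, hδ, h⟩ := 𝔸.mem_chimneyGerm_add_smul (Z := D.facet ε₂ w₂ Set.univ)
    (eventually_of_cl_left heq) hu fun z hz j => by
      have hz := (D.mem_facet_iff.1 hz).1 j (Set.mem_univ j)
      rcases hε with rfl | rfl
      · exact hz
      · rw [D.signedRoot_neg, hz, neg_zero]
  exact ⟨_, δ, hδ, fun τ h0 h1 => ⟨A, hA, f, hf, w₁, w, h τ h0 h1, hw₁, hw, hside, rfl⟩⟩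

/-- The projection does not depend on the base point of the chimney. -/
theorem exists_forall_isProj_eq {ε₁ ε₂ : ℤˣ} {w₂ : D.weyl} (i : ι) {A' : Set I} {f' : V → I}
    (hA' : A' ∈ H.apts) (hf' : f' ∈ H.isom A') (Q : H.SectorGerm ε₁) {u : V}
    (hu : u ∈ D.chamber ε₂ w₂) : ∃ Y, ∀ (τ : ℝ) (Y' : Filter I),
      H.IsProj ε₁ ε₂ w₂ i f' Q.1 (τ • u) Y' → Y' = Y := by
  have hu' : -u ∈ D.chamber (-ε₂) w₂ := by
    rw [VectorialWeylData.mem_chamber_iff] at hu ⊢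
    intro j
    rw [D.signedRoot_neg, map_neg, neg_neg]
    exact hu j
  have hex : ∀ τ : ℝ, ∃ Y, H.IsProj ε₁ ε₂ w₂ i f' Q.1 (τ • u) Y := fun τ => by
    obtain ⟨Y, δ, hδ, h⟩ := H.exists_isProj_add_smul i hA' hf' Q (τ • u) hu (Or.inl rfl)
    have := h 0 le_rfl hδ
    rw [zero_smul, add_zero] at this
    exact ⟨Y, this⟩
  choose Y hY using hex
  -- The alcoves on the two sides give constancy on a right and a left neighbourhood, both including
  -- τ, so the two values agree there.
  have hloc : IsLocallyConstant Y := by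
    rw [IsLocallyConstant.iff_eventually_eq]
    intro τ
    obtain ⟨Y₁, δ₁, hδ₁, h₁⟩ := H.exists_isProj_add_smul i hA' hf' Q (τ • u) hu (Or.inl rfl)
    obtain ⟨Y₂, δ₂, hδ₂, h₂⟩ := H.exists_isProj_add_smul i hA' hf' Q (τ • u) hu' (Or.inr rfl)
    have k₁ : ∀ σ, τ ≤ σ → σ < τ + δ₁ → Y σ = Y₁ := fun σ hσ hσ' => by
      have := h₁ (σ - τ) (by linarith) (by linarith)
      rw [← add_smul, add_sub_cancel] at this
      exact (hY σ).unique H this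
    have k₂ : ∀ σ, σ ≤ τ → τ - δ₂ < σ → Y σ = Y₂ := fun σ hσ hσ' => by
      have := h₂ (τ - σ) (by linarith) (by linarith)
      rw [smul_neg, ← sub_eq_add_neg, ← sub_smul, sub_sub_cancel] at this
      exact (hY σ).unique H this
    filter_upwards [Ioo_mem_nhds (show τ - δ₂ < τ by linarith) (show τ < τ + δ₁ by linarith)]
      with σ hσ
    rcases le_total τ σ with h | h
    · rw [k₁ σ h hσ.2, k₁ τ le_rfl (by linarith)]
    · rw [k₂ σ h hσ.1, k₂ τ le_rfl (by linarith)]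
  refine ⟨Y 0, fun τ Y' h => ?_⟩
  rw [h.unique H (hY τ)]
  exact hloc.apply_eq_of_preconnectedSpace τ 0

/-- A chart which coincides with `f'` on a sector germ dominating the panel computes the
projection. -/
theorem exists_isProj_of_eq_on_sectorGerm {ε₁ ε₂ : ℤˣ} {w₂ w' : D.weyl} {i : ι} {f' : V → I}
    {Q : Filter I} {u : V} (hu : u ∈ D.chamber ε₂ w₂) (hw' : w' = w₂ ∨ w' = w₂ * D.simpleRefl i)
    {A : Set I} (hA : A ∈ H.apts) {f : V → I} (hf : f ∈ H.isom A)
    (hff : ∀ᶠ v in sectorGerm (D.chamber ε₂ w'), f v = f' v) {w₁ w : D.weyl}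
    (hQ : Q = chartGerm D f ε₁ w₁) (hw : w = w₂ ∨ w = w₂ * D.simpleRefl i)
    (hside : D.cs.length (w₁⁻¹ * w) < D.cs.length (w₁⁻¹ * w * D.simpleRefl i) ↔ ε₁ = ε₂) :
    ∃ τ : ℝ, H.IsProj ε₁ ε₂ w₂ i f' Q (τ • u) (chartGerm D f ε₂ w) := by
  obtain ⟨q, hq⟩ := mem_sectorGerm.1 hff
  obtain ⟨k, hk, hsub⟩ := 𝔸.exists_levels_subset_add_chamber ε₂ w' q
  have hfacet : D.facet ε₂ w' {i} = D.facet ε₂ w₂ {i} := by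
    rcases hw' with rfl | rfl
    · rfl
    · exact D.facet_mul_simpleRefl ε₂ w₂ i
  have hne : D.signedRoot ε₂ w' i u ≠ 0 := by
    have h0 := D.mem_chamber_iff.1 hu i
    rcases hw' with rfl | rfl
    · exact h0.ne'
    · rw [D.signedRoot_mul_simpleRefl_self]
      exact neg_ne_zero.2 h0.ne'
  -- This τ gives the root ε₂ w' α_i the value 1 - k_i at τu, so the base point is strictly inside
  -- the only half-space that matters. For w' = w₂ r_i the denominator is negative, hence the need
  -- for the whole line ℝu.
  refine ⟨(1 - k i) / D.signedRoot ε₂ w' i u, A, hA, f, hf, w₁, w, ?_, hQ, hw, hside, rfl⟩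
  rw [← hfacet]
  refine mem_of_superset (𝔸.mem_chimneyGerm_of_levels (J := {i}) hk _ ?_) fun v hv => ?_
  · rintro j rfl
    rw [map_smul, smul_eq_mul, div_mul_cancel₀ _ hne]
    linarith
  · have := hq _ (hsub v hv)
    rwa [add_sub_cancel] at this

/-- Q₁ and Q₂ need not lie in a common apartment with Q; their positions are compared through the
common projection Y of Q onto their panel. The equivalence in the second part says that Q₁ is this
projection. -/
theorem relPos_adjacent {ε₁ ε₂ : ℤˣ} (Q : H.SectorGerm ε₁) (Q₁ Q₂ : H.SectorGerm ε₂) {i : ι}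
    (h : H.relPos Q₁ Q₂ = D.simpleRefl i) :
    (H.relPos Q Q₂ = H.relPos Q Q₁ ∨ H.relPos Q Q₂ = H.relPos Q Q₁ * D.simpleRefl i) ∧
    ((D.cs.length (H.relPos Q Q₁) < D.cs.length (H.relPos Q Q₁ * D.simpleRefl i) ↔ ε₁ = ε₂) →
      H.relPos Q Q₂ = H.relPos Q Q₁ * D.simpleRefl i) := by
  have hne : Q₁ ≠ Q₂ := fun hQ => D.simpleRefl_ne_one i (h ▸ (H.relPos_eq_one_iff Q₁ Q₂).2 hQ)
  obtain ⟨A', f', w₂, w₂', hr⟩ := H.exists_readIn_relPos Q₁ Q₂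
  have hw₂' := hr.relPos_eq
  obtain ⟨hA', hf', hQ₁, hQ₂⟩ := hr
  rw [h, eq_inv_mul_iff_mul_eq] at hw₂'
  subst hw₂'
  obtain ⟨u, hu⟩ := D.exists_mem_chamber ε₂ w₂
  obtain ⟨Y, hY⟩ := H.exists_forall_isProj_eq i hA' hf' Q hu
  have key : ∀ w' : D.weyl, (w' = w₂ ∨ w' = w₂ * D.simpleRefl i) →
      ∀ Q' : H.SectorGerm ε₂, Q'.1 = chartGerm D f' ε₂ w' →
      ∃ A ∈ H.apts, ∃ f ∈ H.isom A, ∃ w₁ w : D.weyl, Q.1 = chartGerm D f ε₁ w₁ ∧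
        Q'.1 = chartGerm D f ε₂ w' ∧ (w = w₂ ∨ w = w₂ * D.simpleRefl i) ∧
        (D.cs.length (w₁⁻¹ * w) < D.cs.length (w₁⁻¹ * w * D.simpleRefl i) ↔ ε₁ = ε₂) ∧
        Y = chartGerm D f ε₂ w := by
    intro w' hw' Q' hQ'
    obtain ⟨A, hA, hAQ, hAQ'⟩ := H.exists_common_apt Q Q'
    rw [hQ'] at hAQ'
    obtain ⟨f, hf, hff⟩ := H.exists_chart_eq_on_sectorGerm hA' hA hf' hAQ'
    obtain ⟨w₁, hw₁⟩ := H.exists_eq_chartGerm Q hA hAQ hf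
    obtain ⟨w, hw, hside⟩ := D.exists_side ε₁ ε₂ w₁ w₂ i
    obtain ⟨τ, hτ⟩ := H.exists_isProj_of_eq_on_sectorGerm hu hw' hA hf hff hw₁ hw hside
    exact ⟨A, hA, f, hf, w₁, w, hw₁, by rw [hQ', chartGerm_congr hff], hw, hside, (hY τ _ hτ).symm⟩
  obtain ⟨A, hA, f, hf, w₁, w, hQ, hQf, hw, hside, hYf⟩ := key w₂ (Or.inl rfl) Q₁ hQ₁
  obtain ⟨B, hB, g, hg, v₁, v, hQ', hQg, hv, hside', hYg⟩ :=
    key (w₂ * D.simpleRefl i) (Or.inr rfl) Q₂ hQ₂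
  let P : H.SectorGerm ε₂ := ⟨Y, A, hA, f, hf, w, hYf⟩
  have e₁ : H.relPos Q Q₁ = w₁⁻¹ * w₂ := ReadIn.relPos_eq ⟨hA, hf, hQ, hQf⟩
  have e₂ : H.relPos Q Q₂ = v₁⁻¹ * (w₂ * D.simpleRefl i) := ReadIn.relPos_eq ⟨hB, hg, hQ', hQg⟩
  have e₃ : H.relPos Q P = w₁⁻¹ * w := ReadIn.relPos_eq ⟨hA, hf, hQ, hYf⟩
  have e₄ : H.relPos Q P = v₁⁻¹ * v := ReadIn.relPos_eq ⟨hB, hg, hQ', hYg⟩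
  rw [e₁, e₂]
  rw [e₃] at e₄
  -- If Y = Q₁, then Y ≠ Q₂, so Q₂ is across the panel from Y. Otherwise the side condition fails
  -- for Q₁, and Q₂ may or may not be Y, which gives the two possible values.
  rcases hw with rfl | rfl
  · have hv' : v = w := hv.resolve_right fun h => hne <| Subtype.ext <| by
      rw [hQf, hQg, ← hYf, hYg, h]
    rw [hv'] at e₄
    rw [← mul_assoc, e₄]
    exact ⟨Or.inr rfl, fun _ => rfl⟩
  · have hn : ¬ (D.cs.length (w₁⁻¹ * w₂) < D.cs.length (w₁⁻¹ * w₂ * D.simpleRefl i) ↔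
        ε₁ = ε₂) := by
      rw [← mul_assoc, D.length_lt_mul_simpleRefl_iff] at hside
      tauto
    refine ⟨?_, fun h => absurd h hn⟩
    rcases hv with rfl | rfl
    · left
      rw [← mul_assoc, ← e₄, mul_assoc, mul_assoc, D.simpleRefl_mul_self, mul_one]
    · right
      rw [← e₄, mul_assoc]

/-! ### The building and twinning axioms. -/

theorem isBuilding_dist [Nonempty I] (ε : ℤˣ) : IsBuilding D.cs (H.dist ε) where
  nonempty := H.nonempty_sectorGerm ε
  eq_one_iff := H.relPos_eq_one_iff
  adjacent x y z i h := by
    rw [D.cs_simple] at h ⊢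
    have := H.relPos_adjacent x y z h
    exact ⟨this.1, fun hl => this.2 (iff_of_true hl rfl)⟩
  exists_adjacent x y i := H.exists_adjacent x y (D.cs.simple i)

theorem isHalfTwinning_relPos {ε₁ ε₂ : ℤˣ} (hε : ε₁ ≠ ε₂) :
    IsHalfTwinning D.cs (H.dist ε₂) (H.relPos (ε₁ := ε₁) (ε₂ := ε₂)) where
  adjacent x y z i h hl := by
    rw [D.cs_simple] at h hl ⊢
    -- For opposite signs the equivalence holds with both sides false, so a decrease of length
    -- forces the position to change.
    exact (H.relPos_adjacent x y z h).2 (iff_of_false hl.not_gt hε)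
  exists_adjacent x y i := H.exists_adjacent x y (D.cs.simple i)

end AffineHovel
end

theorem mainTheorem3 {V ι I : Type*} [NormedAddCommGroup V] [NormedSpace ℝ V]
    [FiniteDimensional ℝ V] [Fintype ι] [Nonempty I]
    (D : VectorialWeylData V ι) (𝔸 : AffineApartment D) (H : AffineHovel 𝔸 I) :
    -- `d_+`, `d_-` and `d_*` are well defined
    (∀ (ε₁ ε₂ : ℤˣ) (Q₁ : H.SectorGerm ε₁) (Q₂ : H.SectorGerm ε₂),
      (∃ A ∈ H.apts, A ∈ Q₁.1 ∧ A ∈ Q₂.1) ∧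
      (∀ A ∈ H.apts, A ∈ Q₁.1 → A ∈ Q₂.1 → ∀ f ∈ H.isom A, ∃ w₁ w₂, H.ReadIn Q₁ Q₂ A f w₁ w₂) ∧
      (∀ A f w₁ w₂, H.ReadIn Q₁ Q₂ A f w₁ w₂ → H.relPos Q₁ Q₂ = w₁⁻¹ * w₂)) ∧
    -- `d_*` is a twinning between the buildings `(I^{+∞}, d_+)` and `(I^{-∞}, d_-)`
    IsTwinning D.cs (H.dist 1) (H.dist (-1)) H.codistPosNeg H.codistNegPos := by
  refine ⟨fun ε₁ ε₂ Q₁ Q₂ => ⟨H.exists_common_apt Q₁ Q₂,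
    fun A hA h₁ h₂ f hf => H.exists_readIn Q₁ Q₂ hA h₁ h₂ hf,
    fun A f w₁ w₂ h => h.relPos_eq⟩, ?_⟩
  exact
    { building := H.isBuilding_dist 1
      building' := H.isBuilding_dist (-1)
      symm := H.relPos_inv
      half := H.isHalfTwinning_relPos (by decide)
      half' := H.isHalfTwinning_relPos (by decide) }
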